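/- **Setting.** A set of $n\ge 2$ elements is partitioned into $k$ unknown nonempty clusters, $1\le k\le n$. One is given a random symmetric similarity matrix $W=(w_{u,v})$ whose entries, over unordered pairs $\{u,v\}$, are independent; $w_{u,v}$ has density $f_g$ if $u,v$ lie in the same cluster and density $f_r$ otherwise. A randomized adaptive algorithm sees $W$ and its own random seed, and repeatedly asks a perfect oracle whether a pair of elements lies in the same cluster; at some time it stops and outputs a partition. It may depend on $n$, $k$, $f_g$ and $f_r$. It is called exact if, for every partition, it outputs that partition with probability $1$; if $2\le k<n$ this is only required for the partitions with exactly $k$ clusters (the algorithm may know $k$). For $0<\varepsilon<1/2$ consider the following densities, which vanish where nothing is specified. * Dist-1: $f_r=1+\varepsilon$ on $[0,\tfrac12)$ and $1-\varepsilon$ on $[\tfrac12,1]$; $f_g=1-\varepsilon$ on $[0,\tfrac12)$ and $1+\varepsilon$ on $[\tfrac12,1]$. * Dist-2: $f_r=\frac1{1-\varepsilon}$ on $[0,1-\varepsilon]$; $f_g=\frac1{1-\varepsilon}$ on $[\varepsilon,1]$. **Proposition (lower bound).** There is an absolute constant $c>0$ such that, for all $n\ge2$, $1\le k\le n$ and $0<\varepsilon<1/2$: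 1. For every exact algorithm under Dist-1 there is a partition into $k$ clusters on which the expected number of queries is at least $c\left(n+\min\{k^2/\varepsilon^2,\,nk\}\right)$. 2. For every exact algorithm under Dist-2 there is a partition into $k$ clusters on which, with positive probability, the number of queries is at least $c\left(n+\min\{k^2/\varepsilon,\,nk\}\right)$. Thus an algorithm that always makes fewer queries is not exact. If moreover $k\ge3$ and $\varepsilon\le 1/4$, then there is a partition into $k$ clusters on which the expected number of queries is at least $c\min\{k^2/\varepsilon,\,nk\}$. In particular the bounds are $c(n+k^2/\varepsilon^2)$ when $k\le\varepsilon^2 n$ under Dist-1, and $c(n+k^2/\varepsilon)$ (for the number of queries with positive probability) when $k\le\varepsilon n$ under Dist-2. -/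

import Mathlib

open MeasureTheory
open scoped ENNReal

noncomputable section

namespace CrowdER

/-- A clustering of the `n` elements: a partition of `Fin n` into nonempty disjoint clusters. -/
abbrev Clustering (n : ℕ) : Type := Finpartition (Finset.univ : Finset (Fin n))

/-- Both elements of the unordered pair `e` lie in one cluster of `P`. -/
def SameCluster {n : ℕ} (P : Clustering n) (e : Sym2 (Fin n)) : Prop :=
  ∃ C ∈ P.parts, ∀ x ∈ e, x ∈ C

open Classical in
/-- The answer of the (perfect) oracle to the query `e` when the hidden clustering is `P`. -/
def oracle {n : ℕ} (P : Clustering n) (e : Sym2 (Fin n)) : Bool :=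
  decide (SameCluster P e)

open Classical in
/-- The law of the symmetric similarity matrix `W`, given the hidden clustering `P`: the entries
`w e`, over unordered pairs `e`, are independent, with density `fg` if the pair lies in one cluster
and with density `fr` otherwise. (A diagonal entry always has density `fg`, whatever `P` is.) -/
def similarityLaw {n : ℕ} (fg fr : ℝ → ℝ) (P : Clustering n) : Measure (Sym2 (Fin n) → ℝ) :=
  Measure.pi fun e =>
    volume.withDensity fun x => ENNReal.ofReal (if SameCluster P e then fg x else fr x)

/-- A randomized adaptive query algorithm on `n` elements. It draws a random seed from an arbitrary
probability space and sees the similarity matrix; from these and the list of the answers received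
so far (most recent answer first) it either asks the next pair (`Sum.inl`) or stops with an output
clustering (`Sum.inr`). -/
structure Algorithm.{u} (n : ℕ) : Type (u + 1) where
  /-- the set of random seeds -/
  Seed : Type u
  [measurableSpace : MeasurableSpace Seed]
  /-- the law of the random seed -/
  seedLaw : Measure Seed
  [isProbabilityMeasure : IsProbabilityMeasure seedLaw]
  /-- the next move -/
  step : Seed → (Sym2 (Fin n) → ℝ) → List Bool → Sym2 (Fin n) ⊕ Clustering n
  measurableSet_step : ∀ (l : List Bool) (a : Sym2 (Fin n) ⊕ Clustering n),
    MeasurableSet {p : Seed × (Sym2 (Fin n) → ℝ) | step p.1 p.2 l = a}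

attribute [instance] Algorithm.measurableSpace Algorithm.isProbabilityMeasure

namespace Algorithm

variable {n : ℕ} (A : Algorithm n)

/-- The answers received in the first `t` rounds (most recent first), when the hidden clustering is
`P` and `p` consists of the seed and the similarity matrix. Nothing is asked after stopping. -/
def answers (P : Clustering n) (p : A.Seed × (Sym2 (Fin n) → ℝ)) : ℕ → List Bool
  | 0 => []
  | t + 1 =>
    match A.step p.1 p.2 (answers P p t) with
    | Sum.inl e => oracle P e :: answers P p t
    | Sum.inr _ => answers P p t

/-- The algorithm stops with output `Q`. -/
def Outputs (P : Clustering n) (p : A.Seed × (Sym2 (Fin n) → ℝ)) (Q : Clustering n) : Prop :=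
  ∃ t : ℕ, A.step p.1 p.2 (A.answers P p t) = Sum.inr Q

/-- The total number of queries made, `∞` if the algorithm never stops. -/
def numQueries (P : Clustering n) (p : A.Seed × (Sym2 (Fin n) → ℝ)) : ℝ≥0∞ :=
  ⨆ t : ℕ, ((A.answers P p t).length : ℝ≥0∞)

/-- The joint law of the seed and of the similarity matrix, for the hidden clustering `P`. -/
def law (fg fr : ℝ → ℝ) (P : Clustering n) : Measure (A.Seed × (Sym2 (Fin n) → ℝ)) :=
  A.seedLaw.prod (similarityLaw fg fr P)

/-- With probability 1 the algorithm stops and outputs exactly the hidden clustering `P`. -/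
def Recovers (fg fr : ℝ → ℝ) (P : Clustering n) : Prop :=
  ∀ᵐ p ∂(A.law fg fr P), A.Outputs P p P

/-- The expected number of queries on the hidden clustering `P`. -/
def expectedQueries (fg fr : ℝ → ℝ) (P : Clustering n) : ℝ≥0∞ :=
  ∫⁻ p, A.numQueries P p ∂(A.law fg fr P)

/-- The algorithm recovers the clusters with probability 1, whatever they are; or, if
`2 ≤ k < n`, it merely does so whenever there are exactly `k` clusters (it was told `k`).
For `k = 1` and for `k = n` there is only one clustering with `k` clusters. -/
def Exact (fg fr : ℝ → ℝ) (k : ℕ) : Prop :=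
  (∀ P : Clustering n, A.Recovers fg fr P) ∨
    (2 ≤ k ∧ k < n ∧ ∀ P : Clustering n, P.parts.card = k → A.Recovers fg fr P)

end Algorithm

/-- Dist-1, density of the similarity of a pair from different clusters. -/
def dist1r (ε : ℝ) : ℝ → ℝ :=
  Set.indicator (Set.Icc 0 1) fun x => if x < 1 / 2 then 1 + ε else 1 - ε

/-- Dist-1, density of the similarity of a pair from one cluster. -/
def dist1g (ε : ℝ) : ℝ → ℝ :=
  Set.indicator (Set.Icc 0 1) fun x => if x < 1 / 2 then 1 - ε else 1 + ε

/-- Dist-2, density of the similarity of a pair from different clusters. -/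
def dist2r (ε : ℝ) : ℝ → ℝ := Set.indicator (Set.Icc 0 (1 - ε)) fun _ => 1 / (1 - ε)

/-- Dist-2, density of the similarity of a pair from one cluster. -/
def dist2g (ε : ℝ) : ℝ → ℝ := Set.indicator (Set.Icc ε 1) fun _ => 1 / (1 - ε)

end CrowdER

end

/-!
The proof is a search argument. Suppose that the hidden clustering is one of `K` alternatives, which
differ from a null clustering by joining the pairs of disjoint sets `D i`. Until the algorithm
queries a pair of the right set `D i`, all its answers are those for the null clustering. In the
null run, the first `T` queries of such pairs hit at most `T` of the sets, and an algorithm that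
stops without a hit can be right for only one alternative. So, for every value of the data, all but
`T` of the alternatives cost `T` queries (`Algorithm.mul_sum_measure_le`). If a constant part of the
law of the data under alternative `i` has bounded density with respect to the null law, it follows
that the search costs a constant times `K` queries on average (`Algorithm.Confusable.searchBound`).
Such a part exists for `D i` of size `O(1 / ε ^ 2)` under Dist-1, by a second moment bound on the
likelihood ratio (`exists_le_similarityLaw_dist1`), and of size `O(1 / ε)` under Dist-2, where all
the similarities of pairs in `D i` are uninformative, that is in `[ε, 1 - ε]`, with probability
bounded below (`exp_le_similarityLaw_overlap`).

For `k ≤ n / 2`, one takes about `min (n / 2) (k * S)` elements with arbitrary labels among `k - 1`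
clusters, where `S` is `1 / ε ^ 2` or `1 / ε`, and puts the elements left over into one further
cluster. Given the labels of the others, finding the cluster of each such element is a search among
`k - 1` alternatives with sets `D i` of average size at most `S`, so the total is of the order of
`min (k ^ 2 * S) (n * k)` (`Algorithm.SearchBound.exists_le_of_anchors`). For larger `k`, the
algorithm has to find the only joined pair among about `k ^ 2 / 4` pairs
(`Algorithm.SearchBound.exists_le_of_pairs`).

The term `n`, and the cases of boundedly many clusters and of `k = n`, come from exactness when the
laws for different clusterings are mutually absolutely continuous: almost surely the queries must
then separate the hidden clustering from every other admissible one
(`Algorithm.exists_le_lintegral_of_absolutelyContinuous`). This applies to Dist-1, and for the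
worst case under Dist-2 to the law conditioned on all the similarities being uninformative, which
does not depend on the clustering and obeys the search bound for every `S`.

For the expectation under Dist-2, boundedly many alternatives are treated on the event that all the
pairs distinguishing them are uninformative (`Algorithm.search_few_dist2`), and for `k = n` every
pair that is uninformative must be queried
(`Algorithm.exists_le_expectedQueries_dist2_singletons`).
-/

namespace CrowdER

namespace Algorithm

variable {n : ℕ} (A : Algorithm n)

/-! ### Runs of an algorithm -/

/-- The pairs queried in the first `t` rounds, most recent first. -/
noncomputable def queries (P : Clustering n) (p : A.Seed × (Sym2 (Fin n) → ℝ)) :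
    ℕ → List (Sym2 (Fin n))
  | 0 => []
  | t + 1 =>
    match A.step p.1 p.2 ((queries P p t).map (oracle P)) with
    | Sum.inl e => e :: queries P p t
    | Sum.inr _ => queries P p t

theorem answers_eq_map (P : Clustering n) (p : A.Seed × (Sym2 (Fin n) → ℝ)) (t : ℕ) :
    A.answers P p t = (A.queries P p t).map (oracle P) := by
  induction t with
  | zero => rfl
  | succ t ih =>
    simp only [answers, queries, ih]
    cases A.step p.1 p.2 ((A.queries P p t).map (oracle P)) <;> simp

theorem queries_suffix (P : Clustering n) (p : A.Seed × (Sym2 (Fin n) → ℝ)) {s t : ℕ}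
    (h : s ≤ t) : A.queries P p s <:+ A.queries P p t := by
  induction t, h using Nat.le_induction with
  | base => exact List.suffix_rfl
  | succ t _ ih =>
    refine ih.trans ?_
    simp only [queries]
    cases A.step p.1 p.2 ((A.queries P p t).map (oracle P))
    · exact List.suffix_cons _ _
    · exact List.suffix_rfl

/-- As long as the answers to the pairs queried so far coincide for `P` and `Q`, the algorithm
makes the same next move. -/
theorem queries_succ_congr {P Q : Clustering n} {p : A.Seed × (Sym2 (Fin n) → ℝ)} {t : ℕ}
    (h : A.queries P p t = A.queries Q p t)
    (ho : ∀ e ∈ A.queries P p t, oracle P e = oracle Q e) :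
    A.queries P p (t + 1) = A.queries Q p (t + 1) := by
  have := List.map_congr_left ho
  simp only [queries]
  rw [this, h]

theorem answers_eq_of_le {P : Clustering n} {p : A.Seed × (Sym2 (Fin n) → ℝ)} {t : ℕ}
    {Q : Clustering n} (h : A.step p.1 p.2 (A.answers P p t) = Sum.inr Q) {s : ℕ} (hs : t ≤ s) :
    A.answers P p s = A.answers P p t := by
  induction s, hs using Nat.le_induction with
  | base => rfl
  | succ s _ ih => simp only [answers]; rw [ih, h]

theorem Outputs.unique {P : Clustering n} {p : A.Seed × (Sym2 (Fin n) → ℝ)} {Q Q' : Clustering n}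
    (h : A.Outputs P p Q) (h' : A.Outputs P p Q') : Q = Q' := by
  obtain ⟨t, ht⟩ := h
  obtain ⟨t', ht'⟩ := h'
  rcases le_total t t' with hl | hl
  · rw [A.answers_eq_of_le ht hl, ht] at ht'
    exact Sum.inr_injective ht'
  · rw [A.answers_eq_of_le ht' hl, ht'] at ht
    exact (Sum.inr_injective ht).symm

theorem Outputs.congr {P Q : Clustering n} {p : A.Seed × (Sym2 (Fin n) → ℝ)} {R : Clustering n}
    (hq : ∀ t, A.queries P p t = A.queries Q p t)
    (ho : ∀ t, ∀ e ∈ A.queries P p t, oracle P e = oracle Q e) (h : A.Outputs P p R) :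
    A.Outputs Q p R := by
  obtain ⟨t, ht⟩ := h
  refine ⟨t, ?_⟩
  rw [answers_eq_map] at ht ⊢
  rwa [← hq t, ← List.map_congr_left (ho t)]

/-- If, for the same seed and similarities, both `P` and `Q` are recovered, then the run on `P`
contains a query whose answers for `P` and `Q` differ. -/
theorem exists_distinguishing_query {P Q : Clustering n} {p : A.Seed × (Sym2 (Fin n) → ℝ)}
    (hP : A.Outputs P p P) (hQ : A.Outputs Q p Q) (h : P ≠ Q) :
    ∃ t, ∃ e ∈ A.queries P p t, oracle P e ≠ oracle Q e := by
  by_contra! hc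
  have hq : ∀ t, A.queries P p t = A.queries Q p t := by
    intro t
    induction t with
    | zero => rfl
    | succ t ih => exact A.queries_succ_congr ih (hc t)
  exact h (Outputs.unique A (Outputs.congr A hq hc hP) hQ)

/-- The number of queries, counted with repetitions, of pairs in `U`. -/
noncomputable def queryCount (U : Finset (Sym2 (Fin n))) (P : Clustering n)
    (p : A.Seed × (Sym2 (Fin n) → ℝ)) : ℝ≥0∞ :=
  ⨆ t : ℕ, ((A.queries P p t).countP (· ∈ U) : ℝ≥0∞)

theorem numQueries_eq (P : Clustering n) (p : A.Seed × (Sym2 (Fin n) → ℝ)) :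
    A.numQueries P p = ⨆ t : ℕ, ((A.queries P p t).length : ℝ≥0∞) := by
  simp [numQueries, answers_eq_map]

theorem queryCount_le_numQueries (U : Finset (Sym2 (Fin n))) (P : Clustering n)
    (p : A.Seed × (Sym2 (Fin n) → ℝ)) : A.queryCount U P p ≤ A.numQueries P p := by
  rw [numQueries_eq]
  exact iSup_mono fun t => by exact_mod_cast List.countP_le_length

/-! ### Measurability -/

theorem measurable_queries (P : Clustering n) (t : ℕ) :
    Measurable[_, ⊤] fun p : A.Seed × (Sym2 (Fin n) → ℝ) => A.queries P p t := by
  induction t with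
  | zero => exact @measurable_const _ _ ⊤ _ _
  | succ t ih =>
    refine @measurable_to_countable' _ _ ⊤ _ _ _ fun l => ?_
    have : (fun p : A.Seed × (Sym2 (Fin n) → ℝ) => A.queries P p (t + 1)) ⁻¹' {l} =
        ⋃ l' : List (Sym2 (Fin n)), ⋃ a : Sym2 (Fin n) ⊕ Clustering n,
          ⋃ _ : (match a with | Sum.inl e => e :: l' | Sum.inr _ => l') = l,
          ({p | A.queries P p t = l'} ∩ {p | A.step p.1 p.2 (l'.map (oracle P)) = a}) := by
      ext p
      simp only [Set.mem_preimage, Set.mem_singleton_iff, Set.mem_iUnion, Set.mem_inter_iff,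
        Set.mem_ofPred_eq, exists_prop, queries]
      constructor
      · intro h
        exact ⟨_, _, h, rfl, rfl⟩
      · rintro ⟨l', a, h, rfl, rfl⟩
        exact h
    rw [this]
    refine MeasurableSet.iUnion fun l' => MeasurableSet.iUnion fun a => MeasurableSet.iUnion
      fun _ => MeasurableSet.inter ?_ (A.measurableSet_step _ _)
    exact ih (t := {l'}) trivial

theorem measurableSet_queries (P : Clustering n) (t : ℕ) (Φ : List (Sym2 (Fin n)) → Prop) :
    MeasurableSet {p : A.Seed × (Sym2 (Fin n) → ℝ) | Φ (A.queries P p t)} :=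
  (A.measurable_queries P t) (show MeasurableSet[⊤] {l | Φ l} from trivial)

theorem measurableSet_outputs (P Q : Clustering n) :
    MeasurableSet {p : A.Seed × (Sym2 (Fin n) → ℝ) | A.Outputs P p Q} := by
  have : {p : A.Seed × (Sym2 (Fin n) → ℝ) | A.Outputs P p Q} = ⋃ t : ℕ, ⋃ l : List (Sym2 (Fin n)),
      ({p | A.queries P p t = l} ∩ {p | A.step p.1 p.2 (l.map (oracle P)) = Sum.inr Q}) := by
    ext p
    simp [Outputs, answers_eq_map]
  rw [this]
  exact MeasurableSet.iUnion fun t => MeasurableSet.iUnion fun l =>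
    (A.measurableSet_queries P t (· = l)).inter (A.measurableSet_step _ _)

theorem measurable_queryCount (U : Finset (Sym2 (Fin n))) (P : Clustering n) :
    Measurable (A.queryCount U P) := by
  refine Measurable.iSup fun t => ?_
  exact @Measurable.comp _ _ _ _ ⊤ _
    (fun l : List (Sym2 (Fin n)) => ((l.countP (· ∈ U) : ℕ) : ℝ≥0∞)) _
    measurable_from_top (A.measurable_queries P t)

/-! ### Searching for the hidden alternative -/

section search

variable {ι : Type*} (P₀ : Clustering n) (P : ι → Clustering n)
  (D : ι → Finset (Sym2 (Fin n))) (U : Finset (Sym2 (Fin n))) (T : ℕ)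

/-- In the run on the null clustering `P₀`, the alternative `i` is hit (a pair of `D i` is queried)
while fewer than `T` queries in `U`, the hit included, have been made. -/
def EarlyHit (i : ι) (p : A.Seed × (Sym2 (Fin n) → ℝ)) : Prop :=
  ∃ t, ∃ e ∈ A.queries P₀ p t, e ∈ D i ∧ (A.queries P₀ p t).countP (· ∈ U) < T

/-- The run on the alternative `P i` recovers `P i` with fewer than `T` queries in `U`. -/
def Guess (i : ι) (p : A.Seed × (Sym2 (Fin n) → ℝ)) : Prop :=
  A.Outputs (P i) p (P i) ∧ ∀ t, (A.queries (P i) p t).countP (· ∈ U) < T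

variable {A P₀ P D U T}

/-- An alternative guessed without being hit in the null run has the same run as the null
clustering: until a pair of `D i` is queried, the answers for `P i` and `P₀` coincide. -/
theorem Guess.queries_eq {i : ι} {p : A.Seed × (Sym2 (Fin n) → ℝ)}
    (hor : ∀ e ∉ D i, oracle (P i) e = oracle P₀ e)
    (hg : A.Guess P U T i p) (hh : ¬ A.EarlyHit P₀ D U T i p) :
    (∀ t, A.queries (P i) p t = A.queries P₀ p t) ∧
      ∀ t, ∀ e ∈ A.queries (P i) p t, oracle (P i) e = oracle P₀ e := by
  have key : ∀ t, A.queries (P i) p t = A.queries P₀ p t →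
      ∀ e ∈ A.queries (P i) p t, oracle (P i) e = oracle P₀ e := by
    intro t ht e he
    refine hor e fun hD => hh ⟨t, e, ht ▸ he, hD, ?_⟩
    rw [← ht]
    exact hg.2 t
  have h1 : ∀ t, A.queries (P i) p t = A.queries P₀ p t := by
    intro t
    induction t with
    | zero => rfl
    | succ t ih => exact A.queries_succ_congr ih (key t ih)
  exact ⟨h1, fun t => key t (h1 t)⟩

open Classical in
/-- Each of the fewer than `T` queries of the null run counted by `EarlyHit` hits at most one
alternative, the sets `D i` being disjoint. -/
theorem card_earlyHit_lt [Fintype ι] (hD : Pairwise (Function.onFun Disjoint D)) (hU : ∀ i, D i ⊆ U)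
    (hT : 0 < T) (p : A.Seed × (Sym2 (Fin n) → ℝ)) :
    (Finset.univ.filter fun i => A.EarlyHit P₀ D U T i p).card < T := by
  set H := Finset.univ.filter fun i => A.EarlyHit P₀ D U T i p with hH
  rcases H.eq_empty_or_nonempty with h0 | hne
  · simpa [h0] using hT
  -- All the hits are visible at the latest of the times `τ i`, where fewer than `T` queries in `U`
  -- have been made.
  have hex : ∀ i : ι, ∃ t : ℕ, i ∈ H →
      ∃ e ∈ A.queries P₀ p t, e ∈ D i ∧ (A.queries P₀ p t).countP (· ∈ U) < T := by
    intro i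
    by_cases hi : i ∈ H
    · obtain ⟨t, ht⟩ := (Finset.mem_filter.1 hi).2
      exact ⟨t, fun _ => ht⟩
    · exact ⟨0, fun h => absurd h hi⟩
  choose τ hτ using hex
  obtain ⟨i₀, hi₀, hmax⟩ := H.exists_max_image τ hne
  obtain ⟨_, _, _, hlt⟩ := hτ i₀ hi₀
  refine lt_of_le_of_lt ?_ hlt
  have hex2 : ∀ i : ι, ∃ e : Sym2 (Fin n), i ∈ H → e ∈ A.queries P₀ p (τ i₀) ∧ e ∈ D i := by
    intro i
    by_cases hi : i ∈ H
    · obtain ⟨e, he, hDe, _⟩ := hτ i hi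
      exact ⟨e, fun _ => ⟨(A.queries_suffix P₀ p (hmax i hi)).subset he, hDe⟩⟩
    · obtain ⟨e, _⟩ := hτ i₀ hi₀
      exact ⟨e, fun h => absurd h hi⟩
  choose e he using hex2
  rw [List.countP_eq_length_filter]
  refine le_trans ?_ (List.toFinset_card_le _)
  refine Finset.card_le_card_of_injOn e ?_ ?_
  · intro i hi
    have := he i hi
    simpa using ⟨this.1, hU i this.2⟩
  · intro i hi j hj hij
    by_contra hne
    exact Finset.disjoint_left.1 (hD hne) (he i hi).2 (hij ▸ (he j hj).2)

open Classical in
/-- The alternatives guessed without being hit all have the null run, hence the same output, so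
there is at most one of them. -/
theorem card_hit_or_guess_le [Fintype ι] (hP : Function.Injective P)
    (hD : Pairwise (Function.onFun Disjoint D)) (hU : ∀ i, D i ⊆ U)
    (hor : ∀ i, ∀ e ∉ D i, oracle (P i) e = oracle P₀ e)
    (hT : 0 < T) (p : A.Seed × (Sym2 (Fin n) → ℝ)) :
    (Finset.univ.filter fun i => A.EarlyHit P₀ D U T i p ∨ A.Guess P U T i p).card ≤ T := by
  have h1 := card_earlyHit_lt (A := A) (P₀ := P₀) hD hU hT p
  have h2 : (Finset.univ.filter fun i =>
      ¬ A.EarlyHit P₀ D U T i p ∧ A.Guess P U T i p).card ≤ 1 := by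
    refine Finset.card_le_one.2 fun i hi j hj => hP ?_
    obtain ⟨hi1, hi2⟩ := (Finset.mem_filter.1 hi).2
    obtain ⟨hj1, hj2⟩ := (Finset.mem_filter.1 hj).2
    obtain ⟨a, b⟩ := hi2.queries_eq (hor i) hi1
    obtain ⟨c, d⟩ := hj2.queries_eq (hor j) hj1
    exact Outputs.unique A (Outputs.congr A a b hi2.1) (Outputs.congr A c d hj2.1)
  have h3 : (Finset.univ.filter fun i => A.EarlyHit P₀ D U T i p ∨ A.Guess P U T i p) ⊆
      (Finset.univ.filter fun i => A.EarlyHit P₀ D U T i p) ∪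
      (Finset.univ.filter fun i => ¬ A.EarlyHit P₀ D U T i p ∧ A.Guess P U T i p) := by
    intro i
    simp only [Finset.mem_filter, Finset.mem_union, Finset.mem_univ, true_and]
    tauto
  have := (Finset.card_le_card h3).trans (Finset.card_union_le _ _)
  omega

theorem measurableSet_earlyHit (i : ι) : MeasurableSet {p | A.EarlyHit P₀ D U T i p} := by
  have : {p | A.EarlyHit P₀ D U T i p} = ⋃ t, {p | ∃ e ∈ A.queries P₀ p t,
      e ∈ D i ∧ (A.queries P₀ p t).countP (· ∈ U) < T} := by
    ext p
    simp [EarlyHit]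
  rw [this]
  exact MeasurableSet.iUnion fun t => A.measurableSet_queries P₀ t
    fun l => ∃ e ∈ l, e ∈ D i ∧ l.countP (· ∈ U) < T

theorem measurableSet_guess (i : ι) : MeasurableSet {p | A.Guess P U T i p} := by
  refine (A.measurableSet_outputs _ _).inter ?_
  have : {p | ∀ t, (A.queries (P i) p t).countP (· ∈ U) < T} =
      ⋂ t, {p | (A.queries (P i) p t).countP (· ∈ U) < T} := by
    ext p
    simp
  change MeasurableSet {p | ∀ t, (A.queries (P i) p t).countP (· ∈ U) < T}
  rw [this]
  exact MeasurableSet.iInter fun t => A.measurableSet_queries (P i) t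
    fun l => l.countP (· ∈ U) < T

/-- The search inequality. The alternatives `P i` differ from the null clustering `P₀` only on the
disjoint sets `D i`, and the law `ν i` of the data under the alternative `i` has density at most
`M` with respect to a common measure `μ`. For every value of the data, at most `T` alternatives
are hit early or guessed; for the remaining ones at least `T` queries in `U` are made. -/
theorem mul_sum_measure_le [Fintype ι] (hP : Function.Injective P)
    (hD : Pairwise (Function.onFun Disjoint D)) (hU : ∀ i, D i ⊆ U)
    (hor : ∀ i, ∀ e ∉ D i, oracle (P i) e = oracle P₀ e)
    (ν : ι → Measure (A.Seed × (Sym2 (Fin n) → ℝ))) (μ : Measure (A.Seed × (Sym2 (Fin n) → ℝ)))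
    (M : ℝ≥0∞) (hν : ∀ i, ν i ≤ M • μ) (hrec : ∀ i, ∀ᵐ p ∂ν i, A.Outputs (P i) p (P i)) :
    (T : ℝ≥0∞) * ∑ i, ν i Set.univ ≤
      ∑ i, ∫⁻ p, A.queryCount U (P i) p ∂ν i + T * (M * (T * μ Set.univ)) := by
  classical
  rcases Nat.eq_zero_or_pos T with rfl | hT
  · simp
  set B : ι → Set (A.Seed × (Sym2 (Fin n) → ℝ)) := fun i =>
    {p | A.EarlyHit P₀ D U T i p ∨ A.Guess P U T i p} with hB
  -- Outside `B i`, at least `T` queries in `U` are made on the alternative `i`.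
  have hBm : ∀ i, MeasurableSet (B i) := fun i =>
    (measurableSet_earlyHit i).union (measurableSet_guess i)
  have hsum : ∑ i, μ (B i) ≤ T * μ Set.univ := by
    calc ∑ i, μ (B i)
        = ∫⁻ p, ∑ i, (B i).indicator (1 : A.Seed × (Sym2 (Fin n) → ℝ) → ℝ≥0∞) p ∂μ := by
          rw [lintegral_finsetSum _ fun i _ => (measurable_one.indicator (hBm i))]
          simp [lintegral_indicator_one (hBm _)]
      _ ≤ ∫⁻ _, (T : ℝ≥0∞) ∂μ := by
          refine lintegral_mono fun p => ?_
          have h := card_hit_or_guess_le (A := A) (P₀ := P₀) hP hD hU hor hT p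
          calc ∑ i, (B i).indicator (1 : A.Seed × (Sym2 (Fin n) → ℝ) → ℝ≥0∞) p
              = ((Finset.univ.filter fun i => p ∈ B i).card : ℝ≥0∞) := by
                simp only [Set.indicator_apply, Pi.one_apply]
                rw [Finset.sum_boole]
            _ ≤ T := by exact_mod_cast h
      _ = T * μ Set.univ := by simp
  have hlow : ∀ i, (T : ℝ≥0∞) * ν i (B i)ᶜ ≤ ∫⁻ p, A.queryCount U (P i) p ∂ν i := by
    intro i
    rw [← lintegral_indicator_const (hBm i).compl]
    refine lintegral_mono_ae ?_
    filter_upwards [hrec i] with p hp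
    by_cases hpB : p ∈ B i
    · simp [hpB]
    · have : ¬ A.Guess P U T i p := fun h => hpB (Or.inr h)
      simp only [Guess, hp, true_and, not_forall, not_lt] at this
      obtain ⟨t, ht⟩ := this
      rw [Set.indicator_of_mem (by simpa using hpB)]
      refine le_trans ?_ (le_iSup _ t)
      exact_mod_cast ht
  calc (T : ℝ≥0∞) * ∑ i, ν i Set.univ = ∑ i, (T * ν i (B i)ᶜ + T * ν i (B i)) := by
        rw [Finset.mul_sum]
        refine Finset.sum_congr rfl fun i _ => ?_
        rw [← mul_add, add_comm, measure_add_measure_compl (hBm i)]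
    _ ≤ ∑ i, (∫⁻ p, A.queryCount U (P i) p ∂ν i + T * (M * μ (B i))) := by
        refine Finset.sum_le_sum fun i _ => add_le_add (hlow i) ?_
        gcongr
        exact hν i _
    _ ≤ _ := by
        rw [Finset.sum_add_distrib, ← Finset.mul_sum, ← Finset.mul_sum]
        gcongr

end search

end Algorithm

/-! ### Clusterings given by labels -/

section labels

variable {n : ℕ}

open Classical in
/-- The clustering whose clusters are the nonempty fibres of the labelling `f`. -/
noncomputable def ofLabel (f : Fin n → ℕ) : Clustering n := Finpartition.ofSetoid (Setoid.ker f)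

theorem mem_parts_ofLabel {f : Fin n → ℕ} {C : Finset (Fin n)} :
    C ∈ (ofLabel f).parts ↔ ∃ x, C = Finset.univ.filter fun y => f x = f y := by
  classical
  simp [ofLabel, Finpartition.ofSetoid, Finpartition.ofSetSetoid, eq_comm]

theorem sameCluster_ofLabel {f : Fin n → ℕ} {x y : Fin n} :
    SameCluster (ofLabel f) s(x, y) ↔ f x = f y := by
  simp only [SameCluster, mem_parts_ofLabel]
  constructor
  · rintro ⟨_, ⟨z, rfl⟩, h⟩
    have h1 := h x (by simp)
    have h2 := h y (by simp)
    simp only [Finset.mem_filter, Finset.mem_univ, true_and] at h1 h2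
    rw [← h1, ← h2]
  · intro h
    exact ⟨_, ⟨x, rfl⟩, by simp [h]⟩

theorem card_parts_ofLabel (f : Fin n → ℕ) :
    (ofLabel f).parts.card = (Finset.univ.image f).card := by
  have : (ofLabel f).parts =
      (Finset.univ.image f).image fun a => Finset.univ.filter fun y => a = f y := by
    ext C
    simp [mem_parts_ofLabel, eq_comm]
  rw [this, Finset.card_image_of_injOn]
  intro a ha b hb hab
  obtain ⟨x, _, rfl⟩ := Finset.mem_image.1 ha
  have hx : x ∈ Finset.univ.filter fun y => f x = f y := by simp
  simp only at hab
  rw [hab] at hx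
  exact (Finset.mem_filter.1 hx).2.symm

theorem card_parts_ofLabel_eq {f : Fin n → ℕ} {s : Finset ℕ} (h1 : ∀ x, f x ∈ s)
    (h2 : ∀ a ∈ s, ∃ x, f x = a) : (ofLabel f).parts.card = s.card := by
  rw [card_parts_ofLabel]
  congr 1
  ext a
  simp only [Finset.mem_image, Finset.mem_univ, true_and]
  exact ⟨fun ⟨x, hx⟩ => hx ▸ h1 x, h2 a⟩

/-- The pairs `s(x, y)` where `y ≠ x` has the label `a`: those that become pairs of one cluster when
`x` moves from a cluster of its own to the cluster with label `a`. -/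
def joinEdges (f : Fin n → ℕ) (x : Fin n) (a : ℕ) : Finset (Sym2 (Fin n)) :=
  (Finset.univ.filter fun y => y ≠ x ∧ f y = a).image fun y => s(x, y)

theorem mem_joinEdges {f : Fin n → ℕ} {x : Fin n} {a : ℕ} {e : Sym2 (Fin n)} :
    e ∈ joinEdges f x a ↔ ∃ y, y ≠ x ∧ f y = a ∧ e = s(x, y) := by
  simp [joinEdges, and_assoc, eq_comm]

theorem card_joinEdges (f : Fin n → ℕ) (x : Fin n) (a : ℕ) :
    (joinEdges f x a).card = (Finset.univ.filter fun y => y ≠ x ∧ f y = a).card := by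
  rw [joinEdges, Finset.card_image_of_injective]
  intro y z h
  exact Sym2.congr_right.1 h

theorem disjoint_joinEdges (f : Fin n → ℕ) (x : Fin n) {a b : ℕ} (h : a ≠ b) :
    Disjoint (joinEdges f x a) (joinEdges f x b) := by
  rw [Finset.disjoint_left]
  intro e ha hb
  obtain ⟨y, _, hy, rfl⟩ := mem_joinEdges.1 ha
  obtain ⟨z, _, hz, h'⟩ := mem_joinEdges.1 hb
  have := Sym2.congr_right.1 h'
  subst this
  exact h (hy.symm.trans hz)

/-- Giving the label `a` to an element `x` that was alone in its cluster joins exactly the pairs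
in `joinEdges f x a`. -/
theorem sameCluster_update {f : Fin n → ℕ} {x : Fin n} {a : ℕ} (hx : ∀ y, y ≠ x → f y ≠ f x)
    (e : Sym2 (Fin n)) :
    SameCluster (ofLabel (Function.update f x a)) e ↔
      SameCluster (ofLabel f) e ∨ e ∈ joinEdges f x a := by
  induction e with
  | _ y z =>
    simp only [sameCluster_ofLabel, mem_joinEdges, Function.update_apply]
    by_cases hy : y = x <;> by_cases hz : z = x
    · subst hy hz; simp
    · subst hy
      have := hx z hz
      simp only [hz, if_true, if_false]
      constructor
      · intro h
        exact Or.inr ⟨z, hz, h.symm, rfl⟩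
      · rintro (h | ⟨w, _, hw, h⟩)
        · exact absurd h.symm this
        · rw [Sym2.congr_right.1 h, hw]
    · subst hz
      have := hx y hy
      simp only [hy, if_true, if_false]
      constructor
      · intro h
        exact Or.inr ⟨y, hy, h, Sym2.eq_swap⟩
      · rintro (h | ⟨w, _, hw, h⟩)
        · exact absurd h this
        · rw [Sym2.eq_swap] at h
          rw [Sym2.congr_right.1 h, hw]
    · simp only [hy, hz, if_false]
      constructor
      · exact Or.inl
      · rintro (h | ⟨w, _, hw, h⟩)
        · exact h
        · rcases Sym2.eq_iff.1 h with h | h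
          · exact absurd h.1 hy
          · exact absurd h.2 hz

theorem not_sameCluster_of_mem_joinEdges {f : Fin n → ℕ} {x : Fin n} {a : ℕ}
    (hx : ∀ y, y ≠ x → f y ≠ f x) {e : Sym2 (Fin n)} (he : e ∈ joinEdges f x a) :
    ¬ SameCluster (ofLabel f) e := by
  obtain ⟨y, hy, _, rfl⟩ := mem_joinEdges.1 he
  rw [sameCluster_ofLabel]
  exact fun h => hx y hy h.symm

theorem oracle_eq_iff {P Q : Clustering n} {e : Sym2 (Fin n)} :
    oracle P e = oracle Q e ↔ (SameCluster P e ↔ SameCluster Q e) := by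
  simp [oracle]

end labels

namespace Algorithm

variable {n : ℕ} (A : Algorithm n)

/-! ### The search bound for laws that are hard to distinguish -/

/-- Searching among `K ≥ K₀` alternatives costs `b * K ^ 2` queries in total, that is `b * K` on
average: this holds whenever the alternatives `P i` arise from a null clustering `P₀` by joining
the pairs of disjoint sets `D i` of average size at most `S`, and the algorithm recovers each
alternative almost surely under its law `lam (P i)`. Only queries in the union of the `D i` are
counted. No recovery is required on `P₀`. -/
def SearchBound (lam : Clustering n → Measure (A.Seed × (Sym2 (Fin n) → ℝ))) (S K₀ b : ℝ) :
    Prop :=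
  ∀ (ι : Type) [Fintype ι] (P₀ : Clustering n) (P : ι → Clustering n)
    (D : ι → Finset (Sym2 (Fin n))), Function.Injective P →
    Pairwise (Function.onFun Disjoint D) →
    (∀ i e, SameCluster (P i) e ↔ SameCluster P₀ e ∨ e ∈ D i) →
    (∀ i, ∀ e ∈ D i, ¬ SameCluster P₀ e) →
    (∀ i, ∀ᵐ p ∂lam (P i), A.Outputs (P i) p (P i)) →
    K₀ ≤ Fintype.card ι → ∑ i, ((D i).card : ℝ) ≤ Fintype.card ι * S →
    ENNReal.ofReal (b * (Fintype.card ι : ℝ) ^ 2) ≤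
      ∑ i, ∫⁻ p, A.queryCount (Finset.univ.biUnion D) (P i) p ∂lam (P i)

/-- Joining at most `s` pairs changes the law `lam P₀` of the data into a law `lam P` of which a
part of mass at least `δ` has density at most `M` with respect to `lam P₀`. -/
def Confusable (lam : Clustering n → Measure (A.Seed × (Sym2 (Fin n) → ℝ))) (s M δ : ℝ) : Prop :=
  ∀ (P₀ P : Clustering n) (D : Finset (Sym2 (Fin n))),
    (∀ e, SameCluster P e ↔ SameCluster P₀ e ∨ e ∈ D) → (∀ e ∈ D, ¬ SameCluster P₀ e) →
    (D.card : ℝ) ≤ s → ∃ ν : Measure (A.Seed × (Sym2 (Fin n) → ℝ)),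
      ν ≤ lam P ∧ ν ≤ ENNReal.ofReal M • lam P₀ ∧ ENNReal.ofReal δ ≤ ν Set.univ

variable {A}

/-- At least half of the alternatives have `(D i).card ≤ 2 * S`. The search inequality is applied to
the bounded-density parts of their laws and to `T ≈ K * δ / (4 * M)`. -/
theorem Confusable.searchBound {lam : Clustering n → Measure (A.Seed × (Sym2 (Fin n) → ℝ))}
    [∀ P, IsProbabilityMeasure (lam P)] {S M δ : ℝ} (hS : 0 < S) (hM : 0 < M) (hδ : 0 < δ)
    (h : A.Confusable lam (2 * S) M δ) :
    A.SearchBound lam S (4 * M / δ) (δ ^ 2 / (32 * M)) := by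
  classical
  intro ι _ P₀ P D hP hD hPD hD₀ hrec hK hsum
  set K : ℝ := (Fintype.card ι : ℝ) with hKdef
  set G := Finset.univ.filter fun i => ((D i).card : ℝ) ≤ 2 * S with hG
  -- The average of `(D i).card` is at most `S`, so at most half of them exceed `2 * S`.
  have hGc : K / 2 ≤ G.card := by
    have h1 : ((Gᶜ).card : ℝ) * (2 * S) ≤ K * S := by
      refine le_trans ?_ hsum
      calc ((Gᶜ).card : ℝ) * (2 * S) = ∑ i ∈ Gᶜ, 2 * S := by simp
        _ ≤ ∑ i ∈ Gᶜ, ((D i).card : ℝ) := by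
            refine Finset.sum_le_sum fun i hi => ?_
            have : i ∉ G := by simpa using hi
            simp only [hG, Finset.mem_filter, Finset.mem_univ, true_and, not_le] at this
            exact this.le
        _ ≤ _ := Finset.sum_le_sum_of_subset_of_nonneg (Finset.subset_univ _)
            fun _ _ _ => by positivity
    have h2 : (G.card : ℝ) + (Gᶜ).card = K := by
      rw [hKdef]
      exact_mod_cast Finset.card_add_card_compl G
    have h3 : ((Gᶜ).card : ℝ) * 2 ≤ K := by
      by_contra hc
      push Not at hc
      nlinarith
    linarith
  have hex : ∀ i, ∃ ν : Measure (A.Seed × (Sym2 (Fin n) → ℝ)), ν ≤ lam (P i) ∧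
      ν ≤ ENNReal.ofReal M • lam P₀ ∧ (i ∈ G → ENNReal.ofReal δ ≤ ν Set.univ) := by
    intro i
    by_cases hi : i ∈ G
    · obtain ⟨ν, h1, h2, h3⟩ := h P₀ (P i) (D i) (hPD i) (hD₀ i) (Finset.mem_filter.1 hi).2
      exact ⟨ν, h1, h2, fun _ => h3⟩
    · exact ⟨0, Measure.zero_le _, Measure.zero_le _, fun h => absurd h hi⟩
  choose ν hν1 hν2 hν3 using hex
  set T : ℕ := ⌊K * δ / (4 * M)⌋₊ with hT
  have hx : 1 ≤ K * δ / (4 * M) := by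
    rw [le_div_iff₀ (by positivity)]
    rw [div_le_iff₀ hδ] at hK
    linarith
  have hT1 : (T : ℝ) ≤ K * δ / (4 * M) := Nat.floor_le (by linarith)
  have hT2 : K * δ / (8 * M) ≤ T := by
    have h1 := Nat.lt_floor_add_one (K * δ / (4 * M))
    have h2 : (1 : ℝ) ≤ T := by
      exact_mod_cast (Nat.one_le_floor_iff _).2 hx
    have h3 : K * δ / (8 * M) = K * δ / (4 * M) / 2 := by field_simp; ring
    rw [h3]
    linarith
  have main := mul_sum_measure_le (A := A) (P₀ := P₀) (T := T) (U := Finset.univ.biUnion D) hP hD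
    (fun i => Finset.subset_biUnion_of_mem D (Finset.mem_univ i))
    (fun i e he => oracle_eq_iff.2 (by simp [hPD i e, he])) ν (lam P₀) (ENNReal.ofReal M) hν2
    (fun i => (Measure.absolutelyContinuous_of_le (hν1 i)).ae_le (hrec i))
  have hX : ∑ i, ∫⁻ p, A.queryCount (Finset.univ.biUnion D) (P i) p ∂ν i ≤
      ∑ i, ∫⁻ p, A.queryCount (Finset.univ.biUnion D) (P i) p ∂lam (P i) :=
    Finset.sum_le_sum fun i _ => lintegral_mono' (hν1 i) le_rfl
  refine le_trans ?_ hX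
  have hV : ENNReal.ofReal (K / 2 * δ) ≤ ∑ i, ν i Set.univ := by
    calc ENNReal.ofReal (K / 2 * δ) ≤ ENNReal.ofReal (G.card * δ) :=
          ENNReal.ofReal_le_ofReal (by gcongr)
      _ = ∑ i ∈ G, ENNReal.ofReal δ := by
          rw [ENNReal.ofReal_mul (by positivity)]; simp
      _ ≤ ∑ i ∈ G, ν i Set.univ := Finset.sum_le_sum fun i hi => hν3 i hi
      _ ≤ _ := Finset.sum_le_sum_of_subset (Finset.subset_univ _)
  have h4 : ENNReal.ofReal (T * (K / 2 * δ)) ≤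
      ∑ i, ∫⁻ p, A.queryCount (Finset.univ.biUnion D) (P i) p ∂ν i +
        ENNReal.ofReal (T * (M * T)) := by
    rw [ENNReal.ofReal_mul (by positivity), ENNReal.ofReal_natCast]
    refine (mul_le_mul_right hV _).trans (main.trans (le_of_eq ?_))
    rw [ENNReal.ofReal_mul (by positivity), ENNReal.ofReal_mul (by positivity)]
    simp
  rw [← tsub_le_iff_right, ← ENNReal.ofReal_sub _ (by positivity)] at h4
  refine le_trans (ENNReal.ofReal_le_ofReal ?_) h4
  have h5 : M * T ≤ K * δ / 4 := by
    calc M * T ≤ M * (K * δ / (4 * M)) := by gcongr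
      _ = _ := by field_simp
  calc δ ^ 2 / (32 * M) * K ^ 2 = K * δ / (8 * M) * (K * δ / 4) := by field_simp; ring
    _ ≤ T * (K * δ / 4) := by gcongr
    _ ≤ T * (K / 2 * δ - M * T) := by gcongr; linarith
    _ = _ := by ring

end Algorithm

/-! ### Densities of product measures -/

section product

variable {ι : Type*} [Fintype ι] {X : ι → Type*} [∀ i, MeasurableSpace (X i)]
  (μ : ∀ i, Measure (X i)) [∀ i, IsProbabilityMeasure (μ i)] {r : ∀ i, X i → ℝ≥0∞}

theorem lintegral_pi_prod (hr : ∀ i, Measurable (r i)) (s : Finset ι) :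
    ∫⁻ w, ∏ i ∈ s, r i (w i) ∂Measure.pi μ = ∏ i ∈ s, ∫⁻ x, r i x ∂μ i := by
  rw [ProbabilityTheory.lintegral_prod_eq_prod_lintegral_of_indepFun s
    (fun i (w : ∀ i, X i) => r i (w i))
    (ProbabilityTheory.iIndepFun_pi fun i => (hr i).aemeasurable)
    fun i => (hr i).comp (measurable_pi_apply i)]
  refine Finset.prod_congr rfl fun i _ => ?_
  exact (measurePreserving_eval μ i).lintegral_comp (hr i)

theorem pi_withDensity (hr : ∀ i, Measurable (r i))
    [∀ i, IsProbabilityMeasure ((μ i).withDensity (r i))] :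
    Measure.pi (fun i => (μ i).withDensity (r i)) =
      (Measure.pi μ).withDensity fun w => ∏ i, r i (w i) := by
  refine Measure.pi_eq (μ := fun i => (μ i).withDensity (r i)) fun s hs => ?_
  rw [withDensity_apply _ (MeasurableSet.univ_pi hs),
    ← lintegral_indicator (MeasurableSet.univ_pi hs)]
  have : (Set.univ.pi s).indicator (fun w => ∏ i, r i (w i)) =
      fun w => ∏ i, (s i).indicator (r i) (w i) := by
    funext w
    by_cases hw : w ∈ Set.univ.pi s
    · rw [Set.indicator_of_mem hw]
      exact Finset.prod_congr rfl fun i _ => (Set.indicator_of_mem (hw i trivial) _).symm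
    · rw [Set.indicator_of_notMem hw]
      simp only [Set.mem_pi, Set.mem_univ, forall_const, not_forall] at hw
      obtain ⟨i, hi⟩ := hw
      exact (Finset.prod_eq_zero (Finset.mem_univ i) (Set.indicator_of_notMem hi _)).symm
  rw [this, lintegral_pi_prod μ (fun i => (hr i).indicator (hs i))]
  refine Finset.prod_congr rfl fun i _ => ?_
  rw [lintegral_indicator (hs i), withDensity_apply _ (hs i)]

end product

open Classical in
/-- The law of the similarity of the single pair `e`, given the hidden clustering `P`. -/
noncomputable def pairLaw {n : ℕ} (fg fr : ℝ → ℝ) (P : Clustering n) (e : Sym2 (Fin n)) :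
    Measure ℝ :=
  volume.withDensity fun x => ENNReal.ofReal (if SameCluster P e then fg x else fr x)

theorem similarityLaw_eq {n : ℕ} (fg fr : ℝ → ℝ) (P : Clustering n) :
    similarityLaw fg fr P = Measure.pi (pairLaw fg fr P) := rfl

theorem pairLaw_same {n : ℕ} {fg fr : ℝ → ℝ} {P : Clustering n} {e : Sym2 (Fin n)}
    (h : SameCluster P e) :
    pairLaw fg fr P e = volume.withDensity fun x => ENNReal.ofReal (fg x) := by
  simp [pairLaw, h]

theorem pairLaw_diff {n : ℕ} {fg fr : ℝ → ℝ} {P : Clustering n} {e : Sym2 (Fin n)}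
    (h : ¬ SameCluster P e) :
    pairLaw fg fr P e = volume.withDensity fun x => ENNReal.ofReal (fr x) := by
  simp [pairLaw, h]

theorem isProbabilityMeasure_pairLaw {n : ℕ} {fg fr : ℝ → ℝ}
    (hg : IsProbabilityMeasure (volume.withDensity fun x => ENNReal.ofReal (fg x)))
    (hr : IsProbabilityMeasure (volume.withDensity fun x => ENNReal.ofReal (fr x)))
    (P : Clustering n) (e : Sym2 (Fin n)) : IsProbabilityMeasure (pairLaw fg fr P e) := by
  by_cases h : SameCluster P e
  · rwa [pairLaw_same h]
  · rwa [pairLaw_diff h]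

theorem isProbabilityMeasure_similarityLaw {n : ℕ} {fg fr : ℝ → ℝ}
    (hg : IsProbabilityMeasure (volume.withDensity fun x => ENNReal.ofReal (fg x)))
    (hr : IsProbabilityMeasure (volume.withDensity fun x => ENNReal.ofReal (fr x)))
    (P : Clustering n) : IsProbabilityMeasure (similarityLaw fg fr P) := by
  have := isProbabilityMeasure_pairLaw hg hr P
  rw [similarityLaw_eq]
  infer_instance

/-! ### The similarity matrix under Dist-1 -/

section dist1

variable {ε : ℝ}

/-- The integral of the step function with values `a` on `[0, 1/2)` and `b` on `[1/2, 1]`. -/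
theorem lintegral_two_level (a b : ℝ) (ha : 0 ≤ a) (hb : 0 ≤ b) :
    ∫⁻ x, ENNReal.ofReal ((Set.Icc (0 : ℝ) 1).indicator (fun x => if x < 1 / 2 then a else b) x) =
      ENNReal.ofReal ((a + b) / 2) := by
  have h : ∀ x : ℝ, ENNReal.ofReal
      ((Set.Icc (0 : ℝ) 1).indicator (fun x => if x < 1 / 2 then a else b) x) =
      (Set.Ico (0 : ℝ) (1 / 2)).indicator (fun _ => ENNReal.ofReal a) x +
      (Set.Icc (1 / 2 : ℝ) 1).indicator (fun _ => ENNReal.ofReal b) x := by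
    intro x
    simp only [Set.indicator_apply, Set.mem_Icc, Set.mem_Ico]
    split_ifs <;> first | (exfalso; grind) | simp
  simp_rw [h]
  rw [lintegral_add_left (measurable_const.indicator measurableSet_Ico),
    lintegral_indicator_const measurableSet_Ico, lintegral_indicator_const measurableSet_Icc,
    Real.volume_Ico, Real.volume_Icc, ← ENNReal.ofReal_mul ha, ← ENNReal.ofReal_mul hb,
    ← ENNReal.ofReal_add (by norm_num; positivity) (by norm_num; positivity)]
  congr 1
  ring

theorem measurable_two_level (a b : ℝ) :
    Measurable ((Set.Icc (0 : ℝ) 1).indicator (fun x : ℝ => if x < 1 / 2 then a else b)) :=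
  (Measurable.ite measurableSet_Iio measurable_const measurable_const).indicator measurableSet_Icc

theorem isProbabilityMeasure_dist1r (h0 : 0 < ε) (h1 : ε < 1 / 2) :
    IsProbabilityMeasure (volume.withDensity fun x => ENNReal.ofReal (dist1r ε x)) := by
  constructor
  rw [withDensity_apply _ .univ, Measure.restrict_univ, dist1r,
    lintegral_two_level _ _ (by linarith) (by linarith)]
  norm_num

theorem isProbabilityMeasure_dist1g (h0 : 0 < ε) (h1 : ε < 1 / 2) :
    IsProbabilityMeasure (volume.withDensity fun x => ENNReal.ofReal (dist1g ε x)) := by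
  constructor
  rw [withDensity_apply _ .univ, Measure.restrict_univ, dist1g,
    lintegral_two_level _ _ (by linarith) (by linarith)]
  norm_num

/-- The likelihood ratio of a similarity under Dist-1: the density for a pair of one cluster divided
by the density for a pair from different clusters. Its value outside `[0, 1]` is irrelevant. -/
noncomputable def likelihoodRatio (ε x : ℝ) : ℝ :=
  if x < 1 / 2 then (1 - ε) / (1 + ε) else (1 + ε) / (1 - ε)

theorem measurable_likelihoodRatio : Measurable (likelihoodRatio ε) :=
  Measurable.ite measurableSet_Iio measurable_const measurable_const

theorem dist1r_mul_likelihoodRatio (h0 : 0 < ε) (h1 : ε < 1 / 2) (x : ℝ) :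
    dist1r ε x * likelihoodRatio ε x = dist1g ε x := by
  have : 1 + ε ≠ 0 := by linarith
  have : 1 - ε ≠ 0 := by linarith
  simp only [dist1r, dist1g, likelihoodRatio, Set.indicator_apply]
  split_ifs <;> field_simp <;> simp

theorem likelihoodRatio_pos (h0 : 0 < ε) (h1 : ε < 1 / 2) (x : ℝ) : 0 < likelihoodRatio ε x := by
  have : 0 < 1 + ε := by linarith
  have : 0 < 1 - ε := by linarith
  rw [likelihoodRatio]
  split_ifs <;> positivity

theorem measurable_dist1r : Measurable (dist1r ε) := measurable_two_level _ _

theorem measurable_dist1g : Measurable (dist1g ε) := measurable_two_level _ _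

theorem dist1r_nonneg (h0 : 0 < ε) (h1 : ε < 1 / 2) (x : ℝ) : 0 ≤ dist1r ε x := by
  refine Set.indicator_nonneg (fun y _ => ?_) x
  split_ifs <;> linarith

theorem dist1g_nonneg (h0 : 0 < ε) (h1 : ε < 1 / 2) (x : ℝ) : 0 ≤ dist1g ε x := by
  refine Set.indicator_nonneg (fun y _ => ?_) x
  split_ifs <;> linarith

theorem withDensity_dist1g (h0 : 0 < ε) (h1 : ε < 1 / 2) :
    (volume.withDensity fun x => ENNReal.ofReal (dist1g ε x)) =
      (volume.withDensity fun x => ENNReal.ofReal (dist1r ε x)).withDensity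
        fun x => ENNReal.ofReal (likelihoodRatio ε x) := by
  rw [← withDensity_mul _ measurable_dist1r.ennreal_ofReal
    measurable_likelihoodRatio.ennreal_ofReal]
  congr 1
  funext x
  rw [Pi.mul_apply, ← ENNReal.ofReal_mul (dist1r_nonneg h0 h1 x), dist1r_mul_likelihoodRatio h0 h1]

theorem withDensity_dist1r (h0 : 0 < ε) (h1 : ε < 1 / 2) :
    (volume.withDensity fun x => ENNReal.ofReal (dist1r ε x)) =
      (volume.withDensity fun x => ENNReal.ofReal (dist1g ε x)).withDensity
        fun x => ENNReal.ofReal (likelihoodRatio ε x)⁻¹ := by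
  have hm : Measurable fun x => ENNReal.ofReal (likelihoodRatio ε x)⁻¹ :=
    measurable_likelihoodRatio.inv.ennreal_ofReal
  rw [← withDensity_mul _ measurable_dist1g.ennreal_ofReal hm]
  congr 1
  funext x
  rw [Pi.mul_apply, ← ENNReal.ofReal_mul (dist1g_nonneg h0 h1 x),
    ← dist1r_mul_likelihoodRatio h0 h1, mul_assoc,
    mul_inv_cancel₀ (likelihoodRatio_pos h0 h1 x).ne', mul_one]

/-- The second moment of the likelihood ratio of Dist-1, as its mean under `dist1g`; it exceeds `1`
by the `χ²`-divergence. -/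
theorem lintegral_likelihoodRatio (h0 : 0 < ε) (h1 : ε < 1 / 2) :
    ∫⁻ x, ENNReal.ofReal (likelihoodRatio ε x)
      ∂(volume.withDensity fun x => ENNReal.ofReal (dist1g ε x)) =
      ENNReal.ofReal (1 + 4 * ε ^ 2 / (1 - ε ^ 2)) := by
  have ha : 0 < 1 + ε := by linarith
  have hb : 0 < 1 - ε := by linarith
  rw [lintegral_withDensity_eq_lintegral_mul _ measurable_dist1g.ennreal_ofReal
    measurable_likelihoodRatio.ennreal_ofReal]
  have : ∀ x, ((fun x => ENNReal.ofReal (dist1g ε x)) *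
      fun x => ENNReal.ofReal (likelihoodRatio ε x)) x =
      ENNReal.ofReal ((Set.Icc (0 : ℝ) 1).indicator
        (fun x => if x < 1 / 2 then (1 - ε) ^ 2 / (1 + ε) else (1 + ε) ^ 2 / (1 - ε)) x) := by
    intro x
    rw [Pi.mul_apply, ← ENNReal.ofReal_mul (dist1g_nonneg h0 h1 x)]
    congr 1
    simp only [dist1g, likelihoodRatio, Set.indicator_apply]
    split_ifs
    · field_simp
    · field_simp
    · simp
    · simp
  simp_rw [this]
  rw [lintegral_two_level _ _ (by positivity) (by positivity)]
  congr 1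
  have hc : 1 - ε ^ 2 ≠ 0 := by nlinarith
  have hd : 1 - ε ^ 2 = (1 - ε) * (1 + ε) := by ring
  rw [hd]
  field_simp
  ring

theorem similarityLaw_dist1_absolutelyContinuous {n : ℕ} (h0 : 0 < ε) (h1 : ε < 1 / 2)
    (P Q : Clustering n) :
    similarityLaw (dist1g ε) (dist1r ε) P ≪ similarityLaw (dist1g ε) (dist1r ε) Q := by
  have hprob := fun P : Clustering n => isProbabilityMeasure_pairLaw
    (isProbabilityMeasure_dist1g h0 h1) (isProbabilityMeasure_dist1r h0 h1) P
  have hex : ∀ e, ∃ r : ℝ → ℝ≥0∞, Measurable r ∧ pairLaw (dist1g ε) (dist1r ε) P e =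
      (pairLaw (dist1g ε) (dist1r ε) Q e).withDensity r := by
    intro e
    by_cases hP : SameCluster P e <;> by_cases hQ : SameCluster Q e
    · exact ⟨1, measurable_one, by rw [pairLaw_same hP, pairLaw_same hQ, withDensity_one]⟩
    · exact ⟨_, measurable_likelihoodRatio.ennreal_ofReal,
        by rw [pairLaw_same hP, pairLaw_diff hQ, withDensity_dist1g h0 h1]⟩
    · exact ⟨_, measurable_likelihoodRatio.inv.ennreal_ofReal,
        by rw [pairLaw_diff hP, pairLaw_same hQ, withDensity_dist1r h0 h1]; rfl⟩
    · exact ⟨1, measurable_one, by rw [pairLaw_diff hP, pairLaw_diff hQ, withDensity_one]⟩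
  choose r hr hPr using hex
  have hP : pairLaw (dist1g ε) (dist1r ε) P =
      fun e => (pairLaw (dist1g ε) (dist1r ε) Q e).withDensity (r e) := funext hPr
  have h3 : ∀ e, IsProbabilityMeasure ((pairLaw (dist1g ε) (dist1r ε) Q e).withDensity (r e)) :=
    fun e => hPr e ▸ hprob P e
  rw [similarityLaw_eq, similarityLaw_eq, hP, pi_withDensity _ hr]
  exact withDensity_absolutelyContinuous _ _

theorem similarityLaw_dist1_eq_withDensity {n : ℕ} (h0 : 0 < ε) (h1 : ε < 1 / 2)
    {P₀ P : Clustering n} {D : Finset (Sym2 (Fin n))}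
    (hP : ∀ e, SameCluster P e ↔ SameCluster P₀ e ∨ e ∈ D) (hD : ∀ e ∈ D, ¬ SameCluster P₀ e) :
    similarityLaw (dist1g ε) (dist1r ε) P = (similarityLaw (dist1g ε) (dist1r ε) P₀).withDensity
      fun w => ∏ e ∈ D, ENNReal.ofReal (likelihoodRatio ε (w e)) := by
  have hprob := fun P : Clustering n => isProbabilityMeasure_pairLaw
    (isProbabilityMeasure_dist1g h0 h1) (isProbabilityMeasure_dist1r h0 h1) P
  set r : Sym2 (Fin n) → ℝ → ℝ≥0∞ :=
    fun e x => if e ∈ D then ENNReal.ofReal (likelihoodRatio ε x) else 1 with hrdef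
  have hr : ∀ e, Measurable (r e) := by
    intro e
    by_cases he : e ∈ D
    · simpa [hrdef, he] using measurable_likelihoodRatio.ennreal_ofReal
    · simp [hrdef, he]
  have hPr : ∀ e, pairLaw (dist1g ε) (dist1r ε) P e =
      (pairLaw (dist1g ε) (dist1r ε) P₀ e).withDensity (r e) := by
    intro e
    by_cases he : e ∈ D
    · rw [pairLaw_same ((hP e).2 (Or.inr he)), pairLaw_diff (hD e he), withDensity_dist1g h0 h1]
      simp [hrdef, he]
    · have : r e = 1 := by funext x; simp [hrdef, he]
      rw [this, withDensity_one]
      by_cases h : SameCluster P₀ e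
      · rw [pairLaw_same h, pairLaw_same ((hP e).2 (Or.inl h))]
      · rw [pairLaw_diff h, pairLaw_diff (by simp [hP e, h, he])]
  have h3 : ∀ e, IsProbabilityMeasure ((pairLaw (dist1g ε) (dist1r ε) P₀ e).withDensity (r e)) :=
    fun e => hPr e ▸ hprob P e
  rw [similarityLaw_eq, similarityLaw_eq, show pairLaw (dist1g ε) (dist1r ε) P = _ from funext hPr,
    pi_withDensity _ hr]
  congr 1
  funext w
  simp only [hrdef]
  rw [Finset.prod_ite_mem, Finset.univ_inter]

/-- The part of the law of the alternative on which the likelihood ratio `L` of the whole matrix is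
small. The mean of `L` under the alternative is `(1 + 4 ε² / (1 - ε²)) ^ D.card`, which is at most
`exp 11` for `D.card ≤ 2 / ε²`, so Markov's inequality leaves half of the mass. -/
theorem exists_le_similarityLaw_dist1 {n : ℕ} (h0 : 0 < ε) (h1 : ε < 1 / 2)
    {P₀ P : Clustering n} {D : Finset (Sym2 (Fin n))}
    (hP : ∀ e, SameCluster P e ↔ SameCluster P₀ e ∨ e ∈ D) (hD : ∀ e ∈ D, ¬ SameCluster P₀ e)
    (hs : (D.card : ℝ) ≤ 2 * (1 / ε ^ 2)) :
    ∃ ν, ν ≤ similarityLaw (dist1g ε) (dist1r ε) P ∧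
      ν ≤ ENNReal.ofReal (2 * Real.exp 11) • similarityLaw (dist1g ε) (dist1r ε) P₀ ∧
      ENNReal.ofReal (1 / 2) ≤ ν Set.univ := by
  have hprob := fun P : Clustering n => isProbabilityMeasure_pairLaw
    (isProbabilityMeasure_dist1g h0 h1) (isProbabilityMeasure_dist1r h0 h1) P
  have hprob' := fun P : Clustering n => isProbabilityMeasure_similarityLaw
    (isProbabilityMeasure_dist1g h0 h1) (isProbabilityMeasure_dist1r h0 h1) P
  set M : ℝ≥0∞ := ENNReal.ofReal (2 * Real.exp 11) with hM
  set L : (Sym2 (Fin n) → ℝ) → ℝ≥0∞ :=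
    fun w => ∏ e ∈ D, ENNReal.ofReal (likelihoodRatio ε (w e)) with hL
  have hLm : Measurable L := Finset.measurable_prod _ fun e _ =>
    measurable_likelihoodRatio.ennreal_ofReal.comp (measurable_pi_apply e)
  have hlaw := similarityLaw_dist1_eq_withDensity h0 h1 hP hD
  have hmS : MeasurableSet {w | L w < M} := measurableSet_lt hLm measurable_const
  refine ⟨(similarityLaw (dist1g ε) (dist1r ε) P).restrict {w | L w < M},
    Measure.restrict_le_self, ?_, ?_⟩
  · rw [hlaw, restrict_withDensity hmS]
    calc _ ≤ ((similarityLaw (dist1g ε) (dist1r ε) P₀).restrict {w | L w < M}).withDensity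
          (fun _ => M) := by
          refine withDensity_mono ?_
          filter_upwards [ae_restrict_mem hmS] with w hw
          exact le_of_lt hw
      _ = M • (similarityLaw (dist1g ε) (dist1r ε) P₀).restrict {w | L w < M} := withDensity_const _
      _ ≤ _ := by
          gcongr
          exact Measure.restrict_le_self
  · have hEL : ∫⁻ w, L w ∂similarityLaw (dist1g ε) (dist1r ε) P ≤ ENNReal.ofReal (Real.exp 11) := by
      rw [similarityLaw_eq, hL, lintegral_pi_prod _
        (fun _ => measurable_likelihoodRatio.ennreal_ofReal)]
      rw [Finset.prod_congr rfl (g := fun _ => ENNReal.ofReal (1 + 4 * ε ^ 2 / (1 - ε ^ 2)))]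
      · have hpos : 0 < 1 - ε ^ 2 := by nlinarith
        rw [Finset.prod_const, ← ENNReal.ofReal_pow (by positivity)]
        refine ENNReal.ofReal_le_ofReal ?_
        calc (1 + 4 * ε ^ 2 / (1 - ε ^ 2)) ^ D.card
            ≤ (Real.exp (4 * ε ^ 2 / (1 - ε ^ 2))) ^ D.card := by
              gcongr
              rw [add_comm]
              exact Real.add_one_le_exp _
          _ = Real.exp (D.card * (4 * ε ^ 2 / (1 - ε ^ 2))) := by rw [← Real.exp_nat_mul]
          _ ≤ Real.exp 11 := by
              refine Real.exp_le_exp.2 ?_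
              calc (D.card : ℝ) * (4 * ε ^ 2 / (1 - ε ^ 2))
                  ≤ 2 * (1 / ε ^ 2) * (4 * ε ^ 2 / (1 - ε ^ 2)) := by gcongr
                _ = 8 / (1 - ε ^ 2) := by field_simp; norm_num
                _ ≤ 11 := by rw [div_le_iff₀ hpos]; nlinarith
      · intro e he
        rw [pairLaw_same ((hP e).2 (Or.inr he)), lintegral_likelihoodRatio h0 h1]
    have hMp : M ≠ 0 := by simp [hM]; positivity
    have hMt : M ≠ ∞ := ENNReal.ofReal_ne_top
    have hmark : similarityLaw (dist1g ε) (dist1r ε) P {w | M ≤ L w} ≤ ENNReal.ofReal (1 / 2) := by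
      refine (meas_ge_le_lintegral_div hLm.aemeasurable hMp hMt).trans ?_
      refine (ENNReal.div_le_div_right hEL _).trans (le_of_eq ?_)
      rw [hM, ← ENNReal.ofReal_div_of_pos (by positivity)]
      congr 1
      field_simp
    rw [Measure.restrict_apply_univ]
    have hc := prob_add_prob_compl (μ := similarityLaw (dist1g ε) (dist1r ε) P) hmS
    have hcompl : {w | L w < M}ᶜ = {w | M ≤ L w} := by ext; simp
    rw [hcompl] at hc
    have h2 : (1 : ℝ≥0∞) ≤
        similarityLaw (dist1g ε) (dist1r ε) P {w | L w < M} + ENNReal.ofReal (1 / 2) := by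
      rw [← hc]
      gcongr
    rw [← tsub_le_iff_right] at h2
    refine le_trans (le_of_eq ?_) h2
    rw [← ENNReal.ofReal_one, ← ENNReal.ofReal_sub _ (by norm_num)]
    norm_num

end dist1

/-! ### The similarity matrix under Dist-2 -/

section dist2

variable {ε : ℝ}

theorem isProbabilityMeasure_dist2r (h1 : ε < 1 / 2) :
    IsProbabilityMeasure (volume.withDensity fun x => ENNReal.ofReal (dist2r ε x)) := by
  constructor
  have h : ∀ x, ENNReal.ofReal (dist2r ε x) =
      (Set.Icc 0 (1 - ε)).indicator (fun _ => ENNReal.ofReal (1 / (1 - ε))) x := by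
    intro x
    simp only [dist2r, Set.indicator_apply]
    split_ifs <;> simp
  have hp : 0 < 1 - ε := by linarith
  rw [withDensity_apply _ .univ, Measure.restrict_univ]
  simp_rw [h]
  rw [lintegral_indicator_const measurableSet_Icc, Real.volume_Icc,
    ← ENNReal.ofReal_mul (by positivity)]
  rw [sub_zero, one_div_mul_cancel hp.ne', ENNReal.ofReal_one]

theorem isProbabilityMeasure_dist2g (h1 : ε < 1 / 2) :
    IsProbabilityMeasure (volume.withDensity fun x => ENNReal.ofReal (dist2g ε x)) := by
  constructor
  have h : ∀ x, ENNReal.ofReal (dist2g ε x) =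
      (Set.Icc ε 1).indicator (fun _ => ENNReal.ofReal (1 / (1 - ε))) x := by
    intro x
    simp only [dist2g, Set.indicator_apply]
    split_ifs <;> simp
  have hp : 0 < 1 - ε := by linarith
  rw [withDensity_apply _ .univ, Measure.restrict_univ]
  simp_rw [h]
  rw [lintegral_indicator_const measurableSet_Icc, Real.volume_Icc,
    ← ENNReal.ofReal_mul (by positivity)]
  rw [one_div_mul_cancel hp.ne', ENNReal.ofReal_one]

/-- On `[ε, 1 - ε]` both densities of Dist-2 are equal to `1 / (1 - ε)`: a similarity in this
interval carries no information. -/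
theorem restrict_pairLaw_dist2 {n : ℕ} (h0 : 0 < ε) (P : Clustering n) (e : Sym2 (Fin n)) :
    (pairLaw (dist2g ε) (dist2r ε) P e).restrict (Set.Icc ε (1 - ε)) =
      ENNReal.ofReal (1 / (1 - ε)) • volume.restrict (Set.Icc ε (1 - ε)) := by
  have key : ∀ f : ℝ → ℝ, (∀ x ∈ Set.Icc ε (1 - ε), f x = 1 / (1 - ε)) →
      (volume.withDensity fun x => ENNReal.ofReal (f x)).restrict (Set.Icc ε (1 - ε)) =
        ENNReal.ofReal (1 / (1 - ε)) • volume.restrict (Set.Icc ε (1 - ε)) := by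
    intro f hf
    rw [restrict_withDensity measurableSet_Icc, ← withDensity_const]
    refine withDensity_congr_ae ?_
    filter_upwards [ae_restrict_mem measurableSet_Icc] with x hx
    rw [hf x hx]
  by_cases h : SameCluster P e
  · rw [pairLaw_same h]
    refine key _ fun x hx => Set.indicator_of_mem (f := fun _ => 1 / (1 - ε)) ?_
    exact ⟨hx.1, by linarith [hx.2]⟩
  · rw [pairLaw_diff h]
    refine key _ fun x hx => Set.indicator_of_mem (f := fun _ => 1 / (1 - ε)) ?_
    exact ⟨by linarith [hx.1], hx.2⟩

theorem pairLaw_dist2_Icc {n : ℕ} (h0 : 0 < ε) (h1 : ε < 1 / 2) (P : Clustering n)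
    (e : Sym2 (Fin n)) :
    pairLaw (dist2g ε) (dist2r ε) P e (Set.Icc ε (1 - ε)) =
      ENNReal.ofReal ((1 - 2 * ε) / (1 - ε)) := by
  have h := congrArg (fun μ : Measure ℝ => μ Set.univ) (restrict_pairLaw_dist2 h0 P e)
  simp only [Measure.restrict_apply_univ, Measure.smul_apply, Real.volume_Icc, smul_eq_mul] at h
  have hp : 0 < 1 - ε := by linarith
  rw [h, ← ENNReal.ofReal_mul (by positivity)]
  congr 1
  field_simp
  ring

/-- The event that no similarity of a pair in `D` reveals anything under Dist-2. -/
def overlap {n : ℕ} (ε : ℝ) (D : Finset (Sym2 (Fin n))) : Set (Sym2 (Fin n) → ℝ) :=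
  Set.univ.pi fun e => if e ∈ D then Set.Icc ε (1 - ε) else Set.univ

theorem restrict_similarityLaw_overlap {n : ℕ} (h0 : 0 < ε) {P Q : Clustering n}
    {D : Finset (Sym2 (Fin n))} (h : ∀ e ∉ D, SameCluster P e ↔ SameCluster Q e) :
    (similarityLaw (dist2g ε) (dist2r ε) P).restrict (overlap ε D) =
      (similarityLaw (dist2g ε) (dist2r ε) Q).restrict (overlap ε D) := by
  have hs : ∀ P e, SigmaFinite (pairLaw (dist2g ε) (dist2r ε) (n := n) P e) := by
    intro P e
    rw [pairLaw]
    infer_instance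
  rw [similarityLaw_eq, similarityLaw_eq, overlap, Measure.restrict_pi_pi, Measure.restrict_pi_pi]
  congr 1
  funext e
  by_cases he : e ∈ D
  · simp only [he, if_true]
    rw [restrict_pairLaw_dist2 h0, restrict_pairLaw_dist2 h0]
  · simp only [he, if_false]
    by_cases hP : SameCluster P e
    · rw [pairLaw_same hP, pairLaw_same ((h e he).1 hP)]
    · rw [pairLaw_diff hP, pairLaw_diff fun hQ => hP ((h e he).2 hQ)]

theorem similarityLaw_overlap {n : ℕ} (h0 : 0 < ε) (h1 : ε < 1 / 2) (P : Clustering n)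
    (D : Finset (Sym2 (Fin n))) :
    similarityLaw (dist2g ε) (dist2r ε) P (overlap ε D) =
      ENNReal.ofReal (((1 - 2 * ε) / (1 - ε)) ^ D.card) := by
  have hprob := isProbabilityMeasure_pairLaw
    (isProbabilityMeasure_dist2g h1) (isProbabilityMeasure_dist2r h1) P
  rw [similarityLaw_eq, overlap, Measure.pi_pi]
  have : ∀ e, pairLaw (dist2g ε) (dist2r ε) P e (if e ∈ D then Set.Icc ε (1 - ε) else Set.univ) =
      if e ∈ D then ENNReal.ofReal ((1 - 2 * ε) / (1 - ε)) else 1 := by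
    intro e
    split_ifs
    · exact pairLaw_dist2_Icc h0 h1 P e
    · exact measure_univ
  simp_rw [this]
  rw [Finset.prod_ite_mem, Finset.univ_inter, Finset.prod_const, ENNReal.ofReal_pow]
  exact div_nonneg (by linarith) (by linarith)

theorem exp_le_similarityLaw_overlap {n : ℕ} (h0 : 0 < ε) (h1 : ε ≤ 1 / 4) (P : Clustering n)
    (D : Finset (Sym2 (Fin n))) {s : ℝ} (hs : (D.card : ℝ) ≤ s / ε) :
    ENNReal.ofReal (Real.exp (-(2 * s))) ≤
      similarityLaw (dist2g ε) (dist2r ε) P (overlap ε D) := by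
  rw [similarityLaw_overlap h0 (by linarith)]
  refine ENNReal.ofReal_le_ofReal ?_
  have hp : 0 < 1 - ε := by linarith
  have hp' : 0 < 1 - 2 * ε := by linarith
  -- `1 / α = 1 + ε / (1 - 2 ε) ≤ 1 + 2 ε ≤ exp (2 ε)`
  have hα : Real.exp (-(2 * ε)) ≤ (1 - 2 * ε) / (1 - ε) := by
    rw [Real.exp_neg, inv_le_comm₀ (Real.exp_pos _) (by positivity), inv_div]
    refine le_trans ?_ (Real.add_one_le_exp _)
    rw [div_le_iff₀ hp']
    nlinarith
  calc Real.exp (-(2 * s)) ≤ Real.exp (D.card * (-(2 * ε))) := by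
        refine Real.exp_le_exp.2 ?_
        rw [le_div_iff₀ h0] at hs
        nlinarith
    _ = Real.exp (-(2 * ε)) ^ D.card := Real.exp_nat_mul _ _
    _ ≤ _ := by gcongr

end dist2

namespace Algorithm

variable {n : ℕ} (A : Algorithm n) {ε : ℝ}

/-! ### Search bounds for the two distributions -/

theorem confusable_dist1 (h0 : 0 < ε) (h1 : ε < 1 / 2) :
    A.Confusable (A.law (dist1g ε) (dist1r ε)) (2 * (1 / ε ^ 2)) (2 * Real.exp 11) (1 / 2) := by
  have hprob := fun P : Clustering n => isProbabilityMeasure_similarityLaw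
    (isProbabilityMeasure_dist1g h0 h1) (isProbabilityMeasure_dist1r h0 h1) P
  intro P₀ P D hP hD hs
  obtain ⟨ν, h2, h3, h4⟩ := exists_le_similarityLaw_dist1 h0 h1 hP hD hs
  have : IsFiniteMeasure ν := isFiniteMeasure_of_le _ h2
  refine ⟨A.seedLaw.prod ν, Measure.prod_mono le_rfl h2, ?_, ?_⟩
  · rw [law, ← Measure.prod_smul_right]
    have : SFinite (ENNReal.ofReal (2 * Real.exp 11) •
      similarityLaw (dist1g ε) (dist1r ε) P₀) := inferInstance
    exact Measure.prod_mono le_rfl h3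
  · rw [← Set.univ_prod_univ, Measure.prod_prod, measure_univ, one_mul]
    exact h4

/-- The bounded-density part of the law is its restriction to the event that all the similarities of
the joined pairs are uninformative; there, the laws for `P₀` and `P` coincide. -/
theorem confusable_dist2 (h0 : 0 < ε) (h1 : ε ≤ 1 / 4) :
    A.Confusable (A.law (dist2g ε) (dist2r ε)) (2 * (1 / ε)) 1 (Real.exp (-4)) := by
  have hprob := fun P : Clustering n => isProbabilityMeasure_similarityLaw
    (isProbabilityMeasure_dist2g (ε := ε) (by linarith))
    (isProbabilityMeasure_dist2r (ε := ε) (by linarith)) P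
  intro P₀ P D hP hD hs
  have hr : (similarityLaw (dist2g ε) (dist2r ε) P).restrict (overlap ε D) =
      (similarityLaw (dist2g ε) (dist2r ε) P₀).restrict (overlap ε D) :=
    restrict_similarityLaw_overlap h0 fun e he => by simp [hP, he]
  refine ⟨A.seedLaw.prod ((similarityLaw (dist2g ε) (dist2r ε) P).restrict (overlap ε D)),
    Measure.prod_mono le_rfl Measure.restrict_le_self, ?_, ?_⟩
  · rw [hr, ENNReal.ofReal_one, one_smul]
    exact Measure.prod_mono le_rfl Measure.restrict_le_self
  · rw [← Set.univ_prod_univ, Measure.prod_prod, measure_univ, one_mul,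
      Measure.restrict_apply_univ]
    refine le_trans (le_of_eq ?_) (exp_le_similarityLaw_overlap h0 h1 P D (s := 2) ?_)
    · norm_num
    · rw [div_eq_mul_one_div]; exact hs

/-- The search bound under Dist-2 for at most `K` alternatives, but at least two. With
boundedly many alternatives, all the pairs that distinguish them have their similarity in
`[ε, 1 - ε]` with a probability bounded below; on this event the alternatives have the same
law, and at most one of them can be output without a query. -/
theorem search_few_dist2 (h0 : 0 < ε) (h1 : ε ≤ 1 / 4) {ι : Type} [Fintype ι] {K : ℝ}
    (P₀ : Clustering n) (P : ι → Clustering n) (D : ι → Finset (Sym2 (Fin n)))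
    (hP : Function.Injective P) (hD : Pairwise (Function.onFun Disjoint D))
    (hPD : ∀ i e, SameCluster (P i) e ↔ SameCluster P₀ e ∨ e ∈ D i)
    (hrec : ∀ i, ∀ᵐ p ∂A.law (dist2g ε) (dist2r ε) (P i), A.Outputs (P i) p (P i))
    (h2 : 2 ≤ (Fintype.card ι : ℝ)) (hK : (Fintype.card ι : ℝ) ≤ K)
    (hsum : ∑ i, ((D i).card : ℝ) ≤ Fintype.card ι * (1 / ε)) :
    ENNReal.ofReal (Real.exp (-(2 * K)) / (2 * K) * (Fintype.card ι : ℝ) ^ 2) ≤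
      ∑ i, ∫⁻ p, A.queryCount (Finset.univ.biUnion D) (P i) p
        ∂A.law (dist2g ε) (dist2r ε) (P i) := by
  have hprob := fun P : Clustering n => isProbabilityMeasure_similarityLaw
    (isProbabilityMeasure_dist2g (ε := ε) (by linarith))
    (isProbabilityMeasure_dist2r (ε := ε) (by linarith)) P
  set U := Finset.univ.biUnion D with hU
  have hDU : ∀ i, D i ⊆ U := fun i => Finset.subset_biUnion_of_mem D (Finset.mem_univ i)
  -- A common part of the laws of all the alternatives.
  set ρ := A.seedLaw.prod
    ((similarityLaw (dist2g ε) (dist2r ε) P₀).restrict (overlap ε U)) with hρ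
  have hρP : ∀ i, ρ ≤ A.law (dist2g ε) (dist2r ε) (P i) := by
    intro i
    rw [hρ, restrict_similarityLaw_overlap h0 (Q := P i)]
    · exact Measure.prod_mono le_rfl Measure.restrict_le_self
    · intro e he
      have : e ∉ D i := fun h => he (hDU i h)
      simp [hPD, this]
  have hmass : ENNReal.ofReal (Real.exp (-(2 * K))) ≤ ρ Set.univ := by
    rw [hρ, ← Set.univ_prod_univ, Measure.prod_prod, measure_univ, one_mul,
      Measure.restrict_apply_univ]
    refine exp_le_similarityLaw_overlap h0 h1 P₀ U ?_
    calc (U.card : ℝ) ≤ ∑ i, ((D i).card : ℝ) := by exact_mod_cast Finset.card_biUnion_le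
      _ ≤ _ := hsum
      _ = Fintype.card ι / ε := by rw [← div_eq_mul_one_div]
      _ ≤ K / ε := by gcongr
  have hfin : ρ Set.univ ≠ ∞ := by
    rw [hρ]
    exact measure_ne_top _ _
  have main := mul_sum_measure_le (A := A) (P₀ := P₀) (T := 1) (U := U) hP hD hDU
    (fun i e he => oracle_eq_iff.2 (by simp [hPD i e, he])) (fun _ => ρ) ρ 1 (by simp)
    (fun i => (Measure.absolutelyContinuous_of_le (hρP i)).ae_le (hrec i))
  have hX : ∑ i, ∫⁻ p, A.queryCount U (P i) p ∂ρ ≤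
      ∑ i, ∫⁻ p, A.queryCount U (P i) p ∂A.law (dist2g ε) (dist2r ε) (P i) :=
    Finset.sum_le_sum fun i _ => lintegral_mono' (hρP i) le_rfl
  refine le_trans ?_ hX
  simp only [Nat.cast_one, one_mul, Finset.sum_const, Finset.card_univ, nsmul_eq_mul] at main
  have hm : ((Fintype.card ι : ℝ≥0∞) - 1) * ρ Set.univ ≤ ∑ i, ∫⁻ p, A.queryCount U (P i) p ∂ρ := by
    rw [ENNReal.sub_mul fun _ _ => hfin, one_mul, tsub_le_iff_right]
    exact main
  refine le_trans ?_ ((mul_le_mul_right hmass _).trans hm)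
  have : (Fintype.card ι : ℝ≥0∞) - 1 = ENNReal.ofReal (Fintype.card ι - 1) := by
    rw [ENNReal.ofReal_sub _ (by norm_num), ENNReal.ofReal_natCast, ENNReal.ofReal_one]
  rw [this, ← ENNReal.ofReal_mul (by linarith)]
  refine ENNReal.ofReal_le_ofReal ?_
  have hKp : 0 < K := by linarith
  set c : ℝ := (Fintype.card ι : ℝ) with hc
  have hE := Real.exp_pos (-(2 * K))
  calc Real.exp (-(2 * K)) / (2 * K) * c ^ 2 = c ^ 2 / (2 * K) * Real.exp (-(2 * K)) := by ring
    _ ≤ (c - 1) * Real.exp (-(2 * K)) := by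
      gcongr
      rw [div_le_iff₀ (by positivity)]
      nlinarith

theorem searchBound_dist1 (h0 : 0 < ε) (h1 : ε < 1 / 2) :
    A.SearchBound (A.law (dist1g ε) (dist1r ε)) (1 / ε ^ 2) (16 * Real.exp 11)
      ((1 / 2) ^ 2 / (64 * Real.exp 11)) := by
  have hprob := fun P : Clustering n => isProbabilityMeasure_similarityLaw
    (isProbabilityMeasure_dist1g h0 h1) (isProbabilityMeasure_dist1r h0 h1) P
  have : ∀ P, IsProbabilityMeasure (A.law (dist1g ε) (dist1r ε) P) := fun P => by
    rw [law]; infer_instance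
  have h := (A.confusable_dist1 h0 h1).searchBound (by positivity) (by positivity) (by norm_num)
  convert h using 1 <;> ring

/-- The search bound under Dist-2, from two alternatives on. Many alternatives are covered by
`confusable_dist2`, few by `search_few_dist2`. -/
theorem searchBound_dist2 :
    ∃ b : ℝ, 0 < b ∧ ∀ {n : ℕ} (A : Algorithm n) {ε : ℝ}, 0 < ε → ε ≤ 1 / 4 →
      A.SearchBound (A.law (dist2g ε) (dist2r ε)) (1 / ε) 2 b := by
  set K : ℝ := 4 * 1 / Real.exp (-4) with hK
  have hKp : 0 < K := by positivity
  refine ⟨min (Real.exp (-4) ^ 2 / (32 * 1)) (Real.exp (-(2 * K)) / (2 * K)), by positivity, ?_⟩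
  intro n A ε h0 h1
  have hprob := fun P : Clustering n => isProbabilityMeasure_similarityLaw
    (isProbabilityMeasure_dist2g (ε := ε) (by linarith))
    (isProbabilityMeasure_dist2r (ε := ε) (by linarith)) P
  have : ∀ P, IsProbabilityMeasure (A.law (dist2g ε) (dist2r ε) P) := fun P => by
    rw [law]; infer_instance
  intro ι _ P₀ P D hP hD hPD hD₀ hrec hc hsum
  rcases le_total K (Fintype.card ι : ℝ) with hcK | hcK
  · refine le_trans (ENNReal.ofReal_le_ofReal ?_)
      ((A.confusable_dist2 h0 h1).searchBound (by positivity) (by positivity) (by positivity)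
        ι P₀ P D hP hD hPD hD₀ hrec hcK hsum)
    gcongr
    exact min_le_left _ _
  · refine le_trans (ENNReal.ofReal_le_ofReal ?_)
      (A.search_few_dist2 h0 h1 P₀ P D hP hD hPD hrec hc hcK hsum)
    gcongr
    exact min_le_right _ _

/-- The law of the seed and the similarities under Dist-2, conditioned on all the similarities being
uninformative. It does not depend on `P`, see `overlapLaw_eq`. -/
noncomputable def overlapLaw (ε : ℝ) (P : Clustering n) : Measure (A.Seed × (Sym2 (Fin n) → ℝ)) :=
  A.seedLaw.prod (ProbabilityTheory.cond (similarityLaw (dist2g ε) (dist2r ε) P)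
    (overlap ε Finset.univ))

theorem overlapLaw_eq (h0 : 0 < ε) (P Q : Clustering n) : A.overlapLaw ε P = A.overlapLaw ε Q := by
  have h := restrict_similarityLaw_overlap h0 (P := P) (Q := Q) (D := Finset.univ) (by simp)
  rw [overlapLaw, overlapLaw, ProbabilityTheory.cond, ProbabilityTheory.cond, h,
    ← Measure.restrict_apply_univ, h, Measure.restrict_apply_univ]

theorem isProbabilityMeasure_overlapLaw (h0 : 0 < ε) (h1 : ε < 1 / 2) (P : Clustering n) :
    IsProbabilityMeasure (A.overlapLaw ε P) := by
  have hprob := isProbabilityMeasure_similarityLaw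
    (isProbabilityMeasure_dist2g h1) (isProbabilityMeasure_dist2r h1) P
  have : IsProbabilityMeasure (ProbabilityTheory.cond (similarityLaw (dist2g ε) (dist2r ε) P)
      (overlap ε Finset.univ)) := by
    refine ProbabilityTheory.cond_isProbabilityMeasure ?_
    rw [similarityLaw_overlap h0 h1]
    have : 0 < (1 - 2 * ε) / (1 - ε) := div_pos (by linarith) (by linarith)
    simp only [ne_eq, ENNReal.ofReal_eq_zero, not_le]
    positivity
  rw [overlapLaw]
  infer_instance

theorem overlapLaw_absolutelyContinuous (h1 : ε < 1 / 2) (P : Clustering n) :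
    A.overlapLaw ε P ≪ A.law (dist2g ε) (dist2r ε) P := by
  have hprob := isProbabilityMeasure_similarityLaw
    (isProbabilityMeasure_dist2g h1) (isProbabilityMeasure_dist2r h1) P
  exact Measure.AbsolutelyContinuous.rfl.prod ProbabilityTheory.cond_absolutelyContinuous

theorem searchBound_overlapLaw (h0 : 0 < ε) (h1 : ε < 1 / 2) {S : ℝ} (hS : 0 < S) :
    A.SearchBound (A.overlapLaw ε) S 4 (1 / 32) := by
  have := A.isProbabilityMeasure_overlapLaw h0 h1
  have h : A.Confusable (A.overlapLaw ε) (2 * S) 1 1 := by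
    intro P₀ P D _ _ _
    refine ⟨A.overlapLaw ε P, le_rfl, ?_, by simp⟩
    rw [ENNReal.ofReal_one, one_smul, A.overlapLaw_eq h0 P P₀]
  have h' := h.searchBound hS one_pos one_pos
  norm_num at h'
  norm_num
  exact h'

end Algorithm

/-! ### Averaging over labellings -/

theorem exists_le_of_card_mul_le {ι : Type*} [Fintype ι] [Nonempty ι] {c : ℝ≥0∞}
    (g : ι → ℝ≥0∞) (h : (Fintype.card ι : ℝ≥0∞) * c ≤ ∑ i, g i) : ∃ i, c ≤ g i := by
  by_contra! hlt
  obtain ⟨i, -, hi⟩ := Finset.exists_max_image Finset.univ g Finset.univ_nonempty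
  have h1 : ∑ j, g j ≤ (Fintype.card ι : ℝ≥0∞) * g i := by
    simpa using Finset.sum_le_card_nsmul Finset.univ g (g i) fun j hj => hi j hj
  refine absurd (h.trans h1) (not_le.2 ?_)
  exact ENNReal.mul_lt_mul_right (by simp) (by simp) (hlt i)

/-- If, for all the values of the other labels, the cost `V l x` of the element `x` is large on
average over the label of `x`, then the total cost is large for some labelling `l`. -/
theorem exists_le_sum_of_update {α β : Type*} [Fintype α] [DecidableEq α] [Fintype β] [Nonempty β]
    (V : (α → β) → α → ℝ≥0∞) {c : ℝ≥0∞}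
    (h : ∀ l x, c ≤ ∑ b, V (Function.update l x b) x) :
    ∃ l, (Fintype.card α : ℝ≥0∞) * c ≤ Fintype.card β * ∑ x, V l x := by
  have hsw : ∀ x, ∑ l : α → β, ∑ b, V (Function.update l x b) x =
      ∑ l : α → β, ∑ _b : β, V l x := by
    intro x
    rw [← Fintype.sum_prod_type', ← Fintype.sum_prod_type']
    -- Exchanging the new label with the one it replaces.
    have hinv : Function.Involutive fun q : (α → β) × β => (Function.update q.1 x q.2, q.1 x) := by
      rintro ⟨l, b⟩
      simp
    exact Equiv.sum_comp hinv.toPerm (fun q : (α → β) × β => V q.1 x)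
  refine exists_le_of_card_mul_le _ ?_
  calc (Fintype.card (α → β) : ℝ≥0∞) * (Fintype.card α * c)
      = ∑ x : α, ∑ l : α → β, c := by
        simp only [Finset.sum_const, Finset.card_univ, nsmul_eq_mul]
        ring
    _ ≤ ∑ x : α, ∑ l : α → β, ∑ b, V (Function.update l x b) x :=
        Finset.sum_le_sum fun x _ => Finset.sum_le_sum fun l _ => h l x
    _ = ∑ x : α, ∑ l : α → β, ∑ _b : β, V l x := Finset.sum_congr rfl fun x _ => hsw x
    _ = _ := by
        rw [Finset.sum_comm]
        simp [Finset.mul_sum]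

namespace Algorithm

variable {n : ℕ} {A : Algorithm n}

/-! ### Hard families of clusterings -/

theorem queryCount_mono {U V : Finset (Sym2 (Fin n))} (h : U ⊆ V) (P : Clustering n)
    (p : A.Seed × (Sym2 (Fin n) → ℝ)) : A.queryCount U P p ≤ A.queryCount V P p :=
  iSup_mono fun t => by
    have : (A.queries P p t).countP (· ∈ U) ≤ (A.queries P p t).countP (· ∈ V) :=
      List.countP_mono_left fun e _ he => by simpa using h (by simpa using he)
    exact_mod_cast this

/-- The pairs containing `x`, the diagonal pair `s(x, x)` included. -/
def edgesAt (x : Fin n) : Finset (Sym2 (Fin n)) := Finset.univ.filter fun e => x ∈ e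

theorem sum_countP_edgesAt_le {ι : Type*} [Fintype ι] {x : ι → Fin n} (hx : Function.Injective x)
    (l : List (Sym2 (Fin n))) : ∑ i, l.countP (· ∈ edgesAt (x i)) ≤ 2 * l.length := by
  induction l with
  | nil => simp
  | cons e l ih =>
    have he : ∑ i, (if x i ∈ e then 1 else 0) ≤ 2 := by
      rw [Finset.sum_boole, Nat.cast_id]
      induction e with
      | _ a b =>
        refine (Finset.card_le_card_of_injOn (t := {a, b}) x ?_ hx.injOn).trans Finset.card_le_two
        intro i hi
        simpa using hi
    simp only [List.countP_cons, List.length_cons, Finset.sum_add_distrib]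
    have : ∑ i, (if decide (e ∈ edgesAt (x i)) = true then 1 else 0) =
        ∑ i, (if x i ∈ e then 1 else 0) := by
      simp [edgesAt]
    omega

/-- A query involves at most two elements. -/
theorem sum_queryCount_edgesAt_le {ι : Type*} [Fintype ι] {x : ι → Fin n}
    (hx : Function.Injective x) (P : Clustering n) (p : A.Seed × (Sym2 (Fin n) → ℝ)) :
    ∑ i, A.queryCount (edgesAt (x i)) P p ≤ 2 * A.numQueries P p := by
  rw [numQueries_eq, ENNReal.mul_iSup]
  simp only [queryCount]
  rw [ENNReal.finsetSum_iSup_of_monotone]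
  · refine iSup_mono fun t => ?_
    exact_mod_cast sum_countP_edgesAt_le hx _
  · intro i s t hst
    simp only [Nat.cast_le]
    exact (A.queries_suffix P p hst).sublist.countP_le

theorem sum_queryCount_singleton_le (E : Finset (Sym2 (Fin n))) (P : Clustering n)
    (p : A.Seed × (Sym2 (Fin n) → ℝ)) : ∑ e ∈ E, A.queryCount {e} P p ≤ A.numQueries P p := by
  rw [numQueries_eq]
  simp only [queryCount]
  rw [ENNReal.finsetSum_iSup_of_monotone]
  · refine iSup_mono fun t => ?_
    have : ∀ l : List (Sym2 (Fin n)), ∑ e ∈ E, l.countP (· ∈ ({e} : Finset _)) ≤ l.length := by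
      intro l
      induction l with
      | nil => simp
      | cons a l ih =>
        simp only [List.countP_cons, List.length_cons, Finset.sum_add_distrib]
        have : ∑ e ∈ E, (if decide (a ∈ ({e} : Finset _)) = true then 1 else 0) ≤ 1 := by
          simp only [Finset.mem_singleton, decide_eq_true_eq, Finset.sum_ite_eq]
          split_ifs <;> simp
        omega
    exact_mod_cast this _
  · intro i s t hst
    simp only [Nat.cast_le]
    exact (A.queries_suffix P p hst).sublist.countP_le

theorem injective_of_join {ι : Type*} {P₀ : Clustering n} {P : ι → Clustering n}
    {D : ι → Finset (Sym2 (Fin n))} (hD : Pairwise (Function.onFun Disjoint D))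
    (hPD : ∀ i e, SameCluster (P i) e ↔ SameCluster P₀ e ∨ e ∈ D i)
    (hD₀ : ∀ i, ∀ e ∈ D i, ¬ SameCluster P₀ e) (hne : ∀ i, (D i).Nonempty) :
    Function.Injective P := by
  intro i j hij
  by_contra h
  obtain ⟨e, he⟩ := hne i
  have h1 : SameCluster (P j) e := hij ▸ (hPD i e).2 (Or.inr he)
  rcases (hPD j e).1 h1 with h2 | h2
  · exact hD₀ i e he h2
  · exact Finset.disjoint_left.1 (hD h) he h2

variable {lam : Clustering n → Measure (A.Seed × (Sym2 (Fin n) → ℝ))} {S K₀ b : ℝ} {k : ℕ}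

/-- A bound that is useful when `k` is of the order of `n`. The alternatives are the clusterings
where one pair `{a, h₁ + b}` of the first `k` elements is joined, with `a < h₁ = k / 2` and
`h₁ + b < k`, the other ones of these elements are alone, and the remaining `n - k ≥ 1` elements
form one more cluster. -/
theorem SearchBound.exists_le_of_pairs (hb : 0 < b) (hS : 1 ≤ S) (h : A.SearchBound lam S K₀ b)
    (hk : 2 ≤ k) (hkn : k < n) (hK : K₀ ≤ k - 1)
    (hrec : ∀ P : Clustering n, P.parts.card = k → ∀ᵐ p ∂lam P, A.Outputs P p P) :
    ∃ P : Clustering n, P.parts.card = k ∧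
      ENNReal.ofReal (b / 8 * k ^ 2) ≤ ∫⁻ p, A.numQueries P p ∂lam P := by
  obtain ⟨h₁, hh⟩ : ∃ h₁, h₁ = k / 2 := ⟨_, rfl⟩
  have hh1 : 1 ≤ h₁ := by omega
  have hh2 : 2 * h₁ ≤ k := by omega
  have hh3 : k ≤ 2 * h₁ + 1 := by omega
  -- The null clustering, with `k + 1` clusters: the first `k` elements are alone.
  set f : Fin n → ℕ := fun i => min i k with hf
  set x : Fin (k - h₁) → Fin n := fun j => ⟨h₁ + j, by omega⟩ with hx
  have hfx : ∀ j, f (x j) = h₁ + j := by intro j; simp only [hf, hx]; omega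
  have hsing : ∀ j y, y ≠ x j → f y ≠ f (x j) := by
    intro j y hy hxy
    rw [hfx] at hxy
    refine hy (Fin.ext ?_)
    simp only [hf, hx] at hxy ⊢
    omega
  set P : Fin h₁ × Fin (k - h₁) → Clustering n :=
    fun q => ofLabel (Function.update f (x q.2) q.1) with hP
  set D : Fin h₁ × Fin (k - h₁) → Finset (Sym2 (Fin n)) :=
    fun q => joinEdges f (x q.2) q.1 with hD
  have hmem : ∀ q e, e ∈ D q ↔ e = s(x q.2, ⟨q.1, by omega⟩) := by
    intro q e
    rw [hD, mem_joinEdges]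
    constructor
    · rintro ⟨y, _, hy, rfl⟩
      congr 2
      simp only [hf] at hy
      ext
      simp only
      omega
    · rintro rfl
      refine ⟨_, ?_, ?_, rfl⟩
      · intro h'
        have := congrArg Fin.val h'
        simp only [hx] at this
        omega
      · simp only [hf]
        omega
  have hDdisj : Pairwise (Function.onFun Disjoint D) := by
    intro q q' hqq
    rw [Function.onFun, Finset.disjoint_left]
    intro e he he'
    rw [hmem] at he he'
    rw [he] at he'
    refine hqq ?_
    rcases Sym2.eq_iff.1 he' with ⟨h1, h2⟩ | ⟨h1, h2⟩
    · have h1 := congrArg Fin.val h1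
      have h2 := congrArg Fin.val h2
      simp only [hx] at h1 h2
      ext <;> omega
    · have h1 := congrArg Fin.val h1
      simp only [hx] at h1
      omega
  have hPD : ∀ q e, SameCluster (P q) e ↔ SameCluster (ofLabel f) e ∨ e ∈ D q :=
    fun q e => sameCluster_update (hsing q.2) e
  have hD₀ : ∀ q, ∀ e ∈ D q, ¬ SameCluster (ofLabel f) e :=
    fun q e he => not_sameCluster_of_mem_joinEdges (hsing q.2) he
  have hcard : ∀ q, (P q).parts.card = k := by
    intro q
    rw [hP, card_parts_ofLabel_eq (s := (Finset.range (k + 1)).erase (h₁ + q.2))]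
    · rw [Finset.card_erase_of_mem (Finset.mem_range.2 (by omega)), Finset.card_range,
        Nat.add_sub_cancel]
    · intro y
      rw [Function.update_apply, Finset.mem_erase, Finset.mem_range]
      split_ifs with hy
      · omega
      · refine ⟨?_, ?_⟩
        · rw [← hfx]
          exact hsing _ _ hy
        · simp only [hf]
          omega
    · intro a ha
      rw [Finset.mem_erase, Finset.mem_range] at ha
      refine ⟨⟨a, by omega⟩, ?_⟩
      rw [Function.update_of_ne]
      · simp only [hf]
        omega
      · intro h'
        have := congrArg Fin.val h'
        simp only [hx] at this
        omega
  have hDcard : ∀ q, (D q).card = 1 := by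
    intro q
    rw [Finset.card_eq_one]
    exact ⟨_, Finset.ext fun e => by rw [hmem, Finset.mem_singleton]⟩
  set K : ℕ := Fintype.card (Fin h₁ × Fin (k - h₁)) with hKdef
  have hKeq : (K : ℝ) = h₁ * (k - h₁) := by
    rw [hKdef, Fintype.card_prod, Fintype.card_fin, Fintype.card_fin, Nat.cast_mul,
      Nat.cast_sub (by omega)]
  have r1 : (1 : ℝ) ≤ h₁ := by exact_mod_cast hh1
  have r2 : 2 * (h₁ : ℝ) ≤ k := by exact_mod_cast hh2
  have r3 : (k : ℝ) ≤ 2 * h₁ + 1 := by exact_mod_cast hh3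
  have r4 : (2 : ℝ) ≤ k := by exact_mod_cast hk
  have main := h _ (ofLabel f) P D
    (injective_of_join hDdisj hPD hD₀ fun q => Finset.card_pos.1 (by rw [hDcard]; exact one_pos))
    hDdisj hPD hD₀ (fun q => hrec _ (hcard q)) (by rw [← hKdef, hKeq]; nlinarith)
    (by
      simp only [hDcard, Nat.cast_one, Finset.sum_const, Finset.card_univ, nsmul_eq_mul, mul_one]
      rw [← hKdef]
      exact le_mul_of_one_le_right (Nat.cast_nonneg _) hS)
  rw [← hKdef] at main
  have : Nonempty (Fin h₁ × Fin (k - h₁)) := ⟨(⟨0, by omega⟩, ⟨0, by omega⟩)⟩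
  obtain ⟨q, hq⟩ := exists_le_of_card_mul_le (c := ENNReal.ofReal (b * K)) _
    (le_trans (le_of_eq (by
      rw [← hKdef, ← ENNReal.ofReal_natCast, ← ENNReal.ofReal_mul (Nat.cast_nonneg _)]
      congr 1
      ring)) main)
  refine ⟨P q, hcard q, ?_⟩
  refine le_trans (ENNReal.ofReal_le_ofReal ?_)
    (hq.trans (lintegral_mono fun p => A.queryCount_le_numQueries _ _ p))
  rw [hKeq, div_mul_eq_mul_div, mul_div_assoc]
  gcongr
  nlinarith

/-- A bound that is useful when `k ≤ n / 2`. The element `i < k` has the label `i`, the next `m`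
elements have arbitrary labels in `{1, …, k - 1}`, and the other ones have the label `0`, so that
they reveal nothing about the arbitrary labels. Finding the label of each of the `m` elements is
a search among `k - 1` alternatives; the labels of the others are averaged over. -/
theorem SearchBound.exists_le_of_anchors (h : A.SearchBound lam S K₀ b)
    (hk : 2 ≤ k) (hK : K₀ ≤ k - 1) {m : ℕ} (hm : 1 ≤ m) (hmn : k + m ≤ n)
    (hmS : (m : ℝ) ≤ (k - 1) * (S - 1))
    (hrec : ∀ P : Clustering n, P.parts.card = k → ∀ᵐ p ∂lam P, A.Outputs P p P) :
    ∃ P : Clustering n, P.parts.card = k ∧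
      ENNReal.ofReal (b / 2 * (m * (k - 1))) ≤ ∫⁻ p, A.numQueries P p ∂lam P := by
  set f : (Fin m → Fin (k - 1)) → Fin n → ℕ := fun l i =>
    if (i : ℕ) < k then i else if hi : (i : ℕ) - k < m then l ⟨i - k, hi⟩ + 1 else 0 with hf
  set x : Fin m → Fin n := fun j => ⟨k + j, by omega⟩ with hx
  have hxinj : Function.Injective x := by
    intro i j hij
    have := congrArg Fin.val hij
    simp only [hx] at this
    ext
    omega
  have hflt : ∀ l i, f l i < k := by
    intro l i
    simp only [hf]
    split_ifs <;> omega
  have hfanch : ∀ l (a : ℕ) (ha : a < k), f l ⟨a, by omega⟩ = a := by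
    intro l a ha
    simp [hf, ha]
  have hupd : ∀ l j a, f (Function.update l j a) = Function.update (f l) (x j) (a + 1) := by
    intro l j a
    funext i
    simp only [hf, hx, Function.update_apply, Fin.ext_iff]
    split_ifs <;> omega
  have hcard : ∀ l, (ofLabel (f l)).parts.card = k := by
    intro l
    rw [card_parts_ofLabel_eq (s := Finset.range k) (fun i => Finset.mem_range.2 (hflt l i)),
      Finset.card_range]
    intro a ha
    exact ⟨_, hfanch l a (Finset.mem_range.1 ha)⟩
  have hstep : ∀ l j, ENNReal.ofReal (b * ((k - 1 : ℕ) : ℝ) ^ 2) ≤ ∑ a : Fin (k - 1),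
      ∫⁻ p, A.queryCount (edgesAt (x j)) (ofLabel (f (Function.update l j a))) p
        ∂lam (ofLabel (f (Function.update l j a))) := by
    intro l j
    -- In the null clustering, `x j` is alone, with the fresh label `k`.
    set g : Fin n → ℕ := Function.update (f l) (x j) k with hg
    have hgx : g (x j) = k := Function.update_self _ _ _
    have hgne : ∀ y, y ≠ x j → g y = f l y := fun y hy => Function.update_of_ne hy _ _
    have hsing : ∀ y, y ≠ x j → g y ≠ g (x j) := by
      intro y hy
      rw [hgx, hgne y hy]
      exact (hflt l y).ne
    have hgf : ∀ a : Fin (k - 1), f (Function.update l j a) = Function.update g (x j) (a + 1) := by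
      intro a
      rw [hupd, hg, Function.update_idem]
    set D : Fin (k - 1) → Finset (Sym2 (Fin n)) := fun a => joinEdges g (x j) (a + 1) with hD
    have hDdisj : Pairwise (Function.onFun Disjoint D) := by
      intro a a' haa
      exact disjoint_joinEdges g (x j) fun h' => haa (Fin.ext (by omega))
    have hPD : ∀ a e, SameCluster (ofLabel (f (Function.update l j a))) e ↔
        SameCluster (ofLabel g) e ∨ e ∈ D a := by
      intro a e
      rw [hgf]
      exact sameCluster_update hsing e
    have hD₀ : ∀ a, ∀ e ∈ D a, ¬ SameCluster (ofLabel g) e :=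
      fun a e he => not_sameCluster_of_mem_joinEdges hsing he
    have hne : ∀ a, (D a).Nonempty := by
      intro a
      have ha : (a : ℕ) + 1 < k := by omega
      have hxa : (⟨a + 1, by omega⟩ : Fin n) ≠ x j := by
        intro h'
        have := congrArg Fin.val h'
        simp only [hx] at this
        omega
      exact ⟨_, mem_joinEdges.2 ⟨_, hxa, by rw [hgne _ hxa, hfanch l _ ha], rfl⟩⟩
    -- The elements with a label other than `0` and `k` are among the `k - 1` anchors `1, …, k - 1`
    -- and the `m - 1` elements with an arbitrary label other than `x j`.
    have hDsum : ∑ a, ((D a).card : ℝ) ≤ (k - 1) * S := by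
      have h1 : ∑ a, (D a).card ≤ k + m - 1 - 1 := by
        simp only [hD, card_joinEdges]
        rw [← Finset.card_biUnion]
        · have hc : ((Finset.Ico 1 (k + m)).erase (k + j)).card = k + m - 1 - 1 := by
            rw [Finset.card_erase_of_mem (Finset.mem_Ico.2 (by omega)), Nat.card_Ico]
          rw [← hc]
          refine Finset.card_le_card_of_injOn (fun y : Fin n => (y : ℕ)) ?_ Fin.val_injective.injOn
          intro y hy
          simp only [Finset.coe_biUnion, Finset.coe_filter, Set.mem_iUnion, Finset.mem_univ,
            Finset.mem_coe, true_and, Set.mem_ofPred_eq, exists_prop] at hy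
          obtain ⟨a, hyx, hya⟩ := hy
          rw [hgne y hyx] at hya
          have h2 : (y : ℕ) ≠ k + j := fun h' => hyx (Fin.ext h')
          simp only [Finset.coe_erase, Finset.coe_Ico, Set.mem_sdiff, Set.mem_Ico,
            Set.mem_singleton_iff]
          simp only [hf] at hya
          split_ifs at hya <;> omega
        · intro a _ a' _ haa
          rw [Function.onFun, Finset.disjoint_left]
          intro y hy hy'
          have h3 := (Finset.mem_filter.1 hy).2.2
          have h4 := (Finset.mem_filter.1 hy').2.2
          exact haa (Fin.ext (by omega))
      have h2 : ∑ a, ((D a).card : ℝ) ≤ k + m - 2 := by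
        have h3 : ∑ a, (D a).card + 2 ≤ k + m := by omega
        have h4 : ((∑ a, (D a).card : ℕ) : ℝ) + 2 ≤ k + m := by exact_mod_cast h3
        push_cast at h4
        linarith
      refine h2.trans ?_
      nlinarith
    have hkc : ((k - 1 : ℕ) : ℝ) = k - 1 := by rw [Nat.cast_sub (by omega)]; simp
    have main := h (Fin (k - 1)) (ofLabel g) _ D (injective_of_join hDdisj hPD hD₀ hne) hDdisj hPD
      hD₀ (fun a => hrec _ (hcard _)) (by rw [Fintype.card_fin, hkc]; exact hK)
      (by rw [Fintype.card_fin, hkc]; exact hDsum)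
    rw [Fintype.card_fin] at main
    refine main.trans (Finset.sum_le_sum fun a _ => lintegral_mono fun p => queryCount_mono ?_ _ _)
    intro e he
    obtain ⟨a, -, ha⟩ := Finset.mem_biUnion.1 he
    obtain ⟨y, -, -, rfl⟩ := mem_joinEdges.1 ha
    simp [edgesAt]
  have : Nonempty (Fin (k - 1)) := ⟨⟨0, by omega⟩⟩
  obtain ⟨l, hl⟩ := exists_le_sum_of_update
    (fun l j => ∫⁻ p, A.queryCount (edgesAt (x j)) (ofLabel (f l)) p ∂lam (ofLabel (f l)))
    hstep
  refine ⟨ofLabel (f l), hcard l, ?_⟩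
  rw [Fintype.card_fin, Fintype.card_fin,
    ← lintegral_finsetSum _ fun j _ => A.measurable_queryCount _ _] at hl
  have h2 : ∫⁻ p, ∑ j, A.queryCount (edgesAt (x j)) (ofLabel (f l)) p ∂lam (ofLabel (f l)) ≤
      2 * ∫⁻ p, A.numQueries (ofLabel (f l)) p ∂lam (ofLabel (f l)) := by
    rw [← lintegral_const_mul' _ _ (by simp)]
    exact lintegral_mono fun p => sum_queryCount_edgesAt_le hxinj _ p
  have h3 := hl.trans (mul_le_mul_right h2 _)
  rw [← mul_assoc] at h3
  have hk1 : ((k - 1 : ℕ) : ℝ≥0∞) ≠ 0 := by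
    simp only [ne_eq, Nat.cast_eq_zero]
    omega
  refine (ENNReal.mul_le_mul_iff_right (a := ((k - 1 : ℕ) : ℝ≥0∞) * 2)
    (by simp only [ne_eq, mul_eq_zero, hk1]; simp)
    (ENNReal.mul_ne_top (by simp) (by simp))).1 (le_trans (le_of_eq ?_) h3)
  have hkc : ((k - 1 : ℕ) : ℝ) = k - 1 := by rw [Nat.cast_sub (by omega)]; simp
  rw [← ENNReal.ofReal_natCast, ← ENNReal.ofReal_natCast, ← ENNReal.ofReal_ofNat,
    ← ENNReal.ofReal_mul (by positivity), ← ENNReal.ofReal_mul (by positivity),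
    ← ENNReal.ofReal_mul (by positivity), hkc]
  congr 1
  ring

/-- The two families of clusterings together. The number `m` of elements with an arbitrary label is
taken as large as the sizes of the clusters, at most `S` on average, allow. -/
theorem SearchBound.exists_le (hb : 0 < b) (hS : 2 ≤ S) (h : A.SearchBound lam S K₀ b)
    (hk : 2 ≤ k) (hkn : k < n) (hK : K₀ ≤ k - 1)
    (hrec : ∀ P : Clustering n, P.parts.card = k → ∀ᵐ p ∂lam P, A.Outputs P p P) :
    ∃ P : Clustering n, P.parts.card = k ∧
      ENNReal.ofReal (b / 32 * min ((k : ℝ) ^ 2 * S) (n * k)) ≤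
        ∫⁻ p, A.numQueries P p ∂lam P := by
  have r1 : (2 : ℝ) ≤ k := by exact_mod_cast hk
  rcases le_or_gt (2 * k) n with hc | hc
  · have r2 : 2 * (k : ℝ) ≤ n := by exact_mod_cast hc
    have hx : 1 ≤ ((k : ℝ) - 1) * (S - 1) := by nlinarith
    have hfl1 : 1 ≤ ⌊((k : ℝ) - 1) * (S - 1)⌋₊ := (Nat.one_le_floor_iff _).2 hx
    have hfl := Nat.floor_le (zero_le_one.trans hx)
    obtain ⟨P, hP, hle⟩ := h.exists_le_of_anchors hk hK
      (m := min (n - k) ⌊((k : ℝ) - 1) * (S - 1)⌋₊) (by omega) (by omega)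
      (le_trans (by exact_mod_cast min_le_right _ _) hfl) hrec
    refine ⟨P, hP, le_trans (ENNReal.ofReal_le_ofReal ?_) hle⟩
    rw [div_mul_eq_mul_div, mul_div_assoc, div_mul_eq_mul_div, mul_div_assoc]
    gcongr b * ?_
    rcases le_total (n - k) ⌊((k : ℝ) - 1) * (S - 1)⌋₊ with hm | hm
    · rw [min_eq_left hm, Nat.cast_sub hkn.le]
      refine (div_le_div_of_nonneg_right (min_le_right _ _) (by norm_num)).trans ?_
      nlinarith [mul_le_mul (show (n : ℝ) / 2 ≤ n - k by linarith)
        (show (k : ℝ) / 2 ≤ k - 1 by linarith) (by positivity) (by linarith)]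
    · rw [min_eq_right hm]
      refine (div_le_div_of_nonneg_right (min_le_left _ _) (by norm_num)).trans ?_
      have h1 := Nat.lt_floor_add_one (((k : ℝ) - 1) * (S - 1))
      have h2 : (1 : ℝ) ≤ ⌊((k : ℝ) - 1) * (S - 1)⌋₊ := by exact_mod_cast hfl1
      have h3 : (k : ℝ) / 2 * (S / 2) ≤ (k - 1) * (S - 1) :=
        mul_le_mul (by linarith) (by linarith) (by linarith) (by linarith)
      have h4 : (k : ℝ) * S / 8 ≤ ⌊((k : ℝ) - 1) * (S - 1)⌋₊ := by linarith
      have h5 := mul_le_mul h4 (show (k : ℝ) / 2 ≤ k - 1 by linarith) (by positivity)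
        (by positivity)
      nlinarith
  · have r2 : (n : ℝ) ≤ 2 * k := by exact_mod_cast hc.le
    obtain ⟨P, hP, hle⟩ := h.exists_le_of_pairs hb (by linarith) hk hkn hK hrec
    refine ⟨P, hP, le_trans (ENNReal.ofReal_le_ofReal ?_) hle⟩
    rw [div_mul_eq_mul_div, mul_div_assoc, div_mul_eq_mul_div, mul_div_assoc]
    gcongr b * ?_
    refine (div_le_div_of_nonneg_right (min_le_right _ _) (by norm_num)).trans ?_
    nlinarith

end Algorithm

/-! ### Queries that exactness forces -/

theorem sameCluster_update_of_notMem {n : ℕ} {f : Fin n → ℕ} {x : Fin n} {a : ℕ}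
    {e : Sym2 (Fin n)} (h : x ∉ e) :
    SameCluster (ofLabel (Function.update f x a)) e ↔ SameCluster (ofLabel f) e := by
  induction e with
  | _ y z =>
    simp only [Sym2.mem_iff, not_or] at h
    rw [sameCluster_ofLabel, sameCluster_ofLabel, Function.update_of_ne (Ne.symm h.1),
      Function.update_of_ne (Ne.symm h.2)]

namespace Algorithm

variable {n : ℕ} {A : Algorithm n} {k : ℕ}

theorem one_le_queryCount {P : Clustering n} {p : A.Seed × (Sym2 (Fin n) → ℝ)}
    {U : Finset (Sym2 (Fin n))} {t : ℕ} {e : Sym2 (Fin n)} (he : e ∈ A.queries P p t)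
    (heU : e ∈ U) : 1 ≤ A.queryCount U P p := by
  refine le_trans ?_ (le_iSup _ t)
  have : 0 < (A.queries P p t).countP (· ∈ U) := List.countP_pos_iff.2 ⟨e, he, by simpa using heU⟩
  exact_mod_cast this

theorem card_le_numQueries {P : Clustering n} {p : A.Seed × (Sym2 (Fin n) → ℝ)}
    {E : Finset (Sym2 (Fin n))} (h : ∀ e ∈ E, ∃ t, e ∈ A.queries P p t) :
    (E.card : ℝ≥0∞) ≤ A.numQueries P p := by
  calc (E.card : ℝ≥0∞) = ∑ _e ∈ E, 1 := by simp
    _ ≤ ∑ e ∈ E, A.queryCount {e} P p := Finset.sum_le_sum fun e he => by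
        obtain ⟨t, ht⟩ := h e he
        exact one_le_queryCount ht (Finset.mem_singleton_self e)
    _ ≤ _ := sum_queryCount_singleton_le E P p

/-- In the clustering with `k - 1` singletons and one larger cluster, every element of the latter
must be queried, as otherwise it could belong to the cluster of the element `0` instead, or, for
`k = 1`, to a cluster of its own. -/
theorem le_numQueries_lastCluster (hk : 1 ≤ k) (hkn : k < n) {p : A.Seed × (Sym2 (Fin n) → ℝ)}
    (h : ∀ Q : Clustering n, Q.parts.card = k ∨ k = 1 → A.Outputs Q p Q) :
    ((n - k + 1 : ℕ) : ℝ≥0∞) ≤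
      2 * A.numQueries (ofLabel fun i : Fin n => min (i : ℕ) (k - 1)) p := by
  set f : Fin n → ℕ := fun i => min (i : ℕ) (k - 1) with hf
  set x : Fin (n - k + 1) → Fin n := fun j => ⟨k - 1 + j, by omega⟩ with hx
  have hxinj : Function.Injective x := by
    intro i j hij
    have := congrArg Fin.val hij
    simp only [hx] at this
    ext
    omega
  have hfx : ∀ j, f (x j) = k - 1 := by
    intro j
    simp only [hf, hx]
    omega
  have hPcard : (ofLabel f).parts.card = k := by
    rw [card_parts_ofLabel_eq (s := Finset.range k), Finset.card_range]
    · intro i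
      rw [Finset.mem_range]
      simp only [hf]
      omega
    · intro a ha
      rw [Finset.mem_range] at ha
      refine ⟨⟨a, by omega⟩, ?_⟩
      simp only [hf]
      omega
  have hq : ∀ j, 1 ≤ A.queryCount (edgesAt (x j)) (ofLabel f) p := by
    intro j
    -- Another element of the last cluster.
    obtain ⟨y, hyx, hy⟩ : ∃ y, y ≠ x j ∧ f y = k - 1 := by
      by_cases hj : (j : ℕ) = 0
      · refine ⟨⟨k, hkn⟩, fun h' => ?_, ?_⟩
        · have := congrArg Fin.val h'
          simp only [hx] at this
          omega
        · simp [hf]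
      · refine ⟨⟨k - 1, by omega⟩, fun h' => ?_, ?_⟩
        · have := congrArg Fin.val h'
          simp only [hx] at this
          omega
        · simp [hf]
    -- The label `1` is new for `k = 1`.
    obtain ⟨a, ha⟩ : ∃ a, a = if k = 1 then 1 else 0 := ⟨_, rfl⟩
    have hQ : A.Outputs (ofLabel (Function.update f (x j) a)) p
        (ofLabel (Function.update f (x j) a)) := by
      refine h _ ?_
      by_cases hk1 : k = 1
      · exact Or.inr hk1
      · left
        rw [if_neg hk1] at ha
        rw [card_parts_ofLabel_eq (s := Finset.range k), Finset.card_range]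
        · intro i
          rw [Finset.mem_range, Function.update_apply]
          simp only [hf]
          split_ifs <;> omega
        · intro v hv
          rw [Finset.mem_range] at hv
          by_cases hvk : v = k - 1
          · exact ⟨y, by rw [Function.update_of_ne hyx, hy, hvk]⟩
          · refine ⟨⟨v, by omega⟩, ?_⟩
            rw [Function.update_of_ne]
            · simp only [hf]
              omega
            · intro h'
              have := congrArg Fin.val h'
              simp only [hx] at this
              omega
    have hne : ofLabel f ≠ ofLabel (Function.update f (x j) a) := by
      intro heq
      have h1 : SameCluster (ofLabel f) s(x j, y) := sameCluster_ofLabel.2 (by rw [hfx, hy])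
      rw [heq, sameCluster_ofLabel, Function.update_self, Function.update_of_ne hyx, hy] at h1
      split_ifs at ha <;> omega
    obtain ⟨t, e, he, hne⟩ := exists_distinguishing_query A (h _ (Or.inl hPcard)) hQ hne
    refine one_le_queryCount he ?_
    by_contra hxe
    refine hne (oracle_eq_iff.2 (sameCluster_update_of_notMem ?_).symm)
    simpa [edgesAt] using hxe
  calc ((n - k + 1 : ℕ) : ℝ≥0∞) = ∑ _j : Fin (n - k + 1), 1 := by simp
    _ ≤ ∑ j, A.queryCount (edgesAt (x j)) (ofLabel f) p := Finset.sum_le_sum fun j _ => hq j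
    _ ≤ _ := sum_queryCount_edgesAt_le hxinj _ p

/-- When all the elements are alone, the pair `s(x, y)` must be queried to exclude that it is the
only pair of one cluster. -/
theorem exists_mem_queries_singletons {p : A.Seed × (Sym2 (Fin n) → ℝ)} {x y : Fin n}
    (hxy : x ≠ y)
    (hP : A.Outputs (ofLabel fun i : Fin n => (i : ℕ)) p (ofLabel fun i : Fin n => (i : ℕ)))
    (hQ : A.Outputs (ofLabel (Function.update (fun i : Fin n => (i : ℕ)) x y)) p
      (ofLabel (Function.update (fun i : Fin n => (i : ℕ)) x y))) :
    ∃ t, s(x, y) ∈ A.queries (ofLabel fun i : Fin n => (i : ℕ)) p t := by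
  have hsing : ∀ z : Fin n, z ≠ x → (z : ℕ) ≠ x := fun z hz h' => hz (Fin.ext h')
  have hsame := sameCluster_update (f := fun i : Fin n => (i : ℕ)) (x := x) (a := y) hsing
  have hne : ofLabel (fun i : Fin n => (i : ℕ)) ≠
      ofLabel (Function.update (fun i : Fin n => (i : ℕ)) x y) := by
    intro heq
    have h1 : SameCluster (ofLabel (Function.update (fun i : Fin n => (i : ℕ)) x y)) s(x, y) :=
      (hsame _).2 (Or.inr (mem_joinEdges.2 ⟨y, hxy.symm, rfl, rfl⟩))
    rw [← heq, sameCluster_ofLabel] at h1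
    exact hxy (Fin.ext h1)
  obtain ⟨t, e, he, hoe⟩ := exists_distinguishing_query A hP hQ hne
  refine ⟨t, ?_⟩
  have : e ∈ joinEdges (fun i : Fin n => (i : ℕ)) x y := by
    by_contra hj
    exact hoe (oracle_eq_iff.2 (by rw [hsame]; simp [hj]))
  obtain ⟨z, _, hz, rfl⟩ := mem_joinEdges.1 this
  rwa [Fin.ext hz] at he

theorem card_filter_not_isDiag :
    (Finset.univ.filter fun e : Sym2 (Fin n) => ¬ e.IsDiag).card = n.choose 2 := by
  rw [← Fintype.card_subtype, Sym2.card_subtype_not_diag, Fintype.card_fin]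

theorem le_numQueries_singletons {p : A.Seed × (Sym2 (Fin n) → ℝ)}
    (h : ∀ Q : Clustering n, A.Outputs Q p Q) :
    ((n.choose 2 : ℕ) : ℝ≥0∞) ≤ A.numQueries (ofLabel fun i : Fin n => (i : ℕ)) p := by
  rw [← card_filter_not_isDiag]
  refine card_le_numQueries fun e he => ?_
  induction e with
  | _ x y => exact exists_mem_queries_singletons (by simpa using he) (h _) (h _)

theorem card_parts_singletons : (ofLabel fun i : Fin n => (i : ℕ)).parts.card = n := by
  rw [card_parts_ofLabel_eq (s := Finset.range n), Finset.card_range]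
  · intro i
    simp
  · intro a ha
    rw [Finset.mem_range] at ha
    exact ⟨⟨a, ha⟩, rfl⟩

/-! ### The lower bounds -/

/-- The lower bound for laws that are mutually absolutely continuous: then, almost surely, every
admissible clustering would be recovered from the given data, were it the hidden one. -/
theorem exists_le_lintegral_of_absolutelyContinuous
    {lam : Clustering n → Measure (A.Seed × (Sym2 (Fin n) → ℝ))} {S K₀ b : ℝ}
    [∀ P, IsProbabilityMeasure (lam P)] (hac : ∀ P Q, lam P ≪ lam Q)
    (hex : (∀ P, ∀ᵐ p ∂lam P, A.Outputs P p P) ∨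
      (2 ≤ k ∧ k < n ∧ ∀ P : Clustering n, P.parts.card = k → ∀ᵐ p ∂lam P, A.Outputs P p P))
    (hb : 0 < b) (hS : 2 ≤ S) (hK₀ : 1 ≤ K₀) (hsearch : A.SearchBound lam S K₀ b)
    (hn : 2 ≤ n) (hk : 1 ≤ k) (hkn : k ≤ n) :
    ∃ P : Clustering n, P.parts.card = k ∧
      ENNReal.ofReal (min (1 / (8 * (K₀ + 2) ^ 2)) (b / 64) * (n + min ((k : ℝ) ^ 2 * S) (n * k))) ≤
        ∫⁻ p, A.numQueries P p ∂lam P := by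
  have hexk : ∀ Q : Clustering n, (Q.parts.card = k ∨ k = 1) → ∀ P, ∀ᵐ p ∂lam P,
      A.Outputs Q p Q := by
    intro Q hQ P
    refine (hac P Q).ae_le ?_
    rcases hex with h | ⟨h2, _, h⟩
    · exact h Q
    · exact h Q (hQ.resolve_right (by omega))
  have r1 : (1 : ℝ) ≤ k := by exact_mod_cast hk
  have r2 : (2 : ℝ) ≤ n := by exact_mod_cast hn
  have r3 : (k : ℝ) ≤ n := by exact_mod_cast hkn
  set c := min (1 / (8 * (K₀ + 2) ^ 2)) (b / 64) with hc
  have hc0 : 0 < c := by positivity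
  have hc1 : c * (8 * (K₀ + 2) ^ 2) ≤ 1 := by
    have h1 : c ≤ 1 / (8 * (K₀ + 2) ^ 2) := min_le_left _ _
    rwa [le_div_iff₀ (by positivity)] at h1
  have hc2 : c ≤ b / 64 := min_le_right _ _
  have hc3 : c ≤ 1 / 8 := by nlinarith
  have hmin : min ((k : ℝ) ^ 2 * S) (n * k) ≤ n * k := min_le_right _ _
  have hmin0 : 0 ≤ min ((k : ℝ) ^ 2 * S) (n * k) := by positivity
  have hconst : ∀ (P : Clustering n) (X : ℝ), (∀ᵐ p ∂lam P, ENNReal.ofReal X ≤ A.numQueries P p) →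
      ENNReal.ofReal X ≤ ∫⁻ p, A.numQueries P p ∂lam P := by
    intro P X h
    calc ENNReal.ofReal X = ∫⁻ _, ENNReal.ofReal X ∂lam P := by simp
      _ ≤ _ := lintegral_mono_ae h
  rcases hkn.lt_or_eq with hlt | heq
  · have hlin : ∃ P : Clustering n, P.parts.card = k ∧
        ENNReal.ofReal ((n - k + 1) / 2) ≤ ∫⁻ p, A.numQueries P p ∂lam P := by
      refine ⟨ofLabel fun i : Fin n => min (i : ℕ) (k - 1), ?_, hconst _ _ ?_⟩
      · rw [card_parts_ofLabel_eq (s := Finset.range k), Finset.card_range]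
        · intro i
          rw [Finset.mem_range]
          omega
        · intro a ha
          rw [Finset.mem_range] at ha
          refine ⟨⟨a, by omega⟩, ?_⟩
          simp only
          omega
      · have hall : ∀ᵐ p ∂lam (ofLabel fun i : Fin n => min (i : ℕ) (k - 1)),
            ∀ Q : Clustering n, Q.parts.card = k ∨ k = 1 → A.Outputs Q p Q := by
          rw [ae_all_iff]
          intro Q
          by_cases hQ : Q.parts.card = k ∨ k = 1
          · filter_upwards [hexk Q hQ _] with p hp _ using hp
          · exact Filter.Eventually.of_forall fun p h => absurd h hQ
        filter_upwards [hall] with p hp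
        have h1 := le_numQueries_lastCluster hk hlt hp
        rw [ENNReal.ofReal_div_of_pos (by norm_num)]
        refine ENNReal.div_le_of_le_mul' ?_
        refine le_trans (le_of_eq ?_) (h1.trans (le_of_eq ?_))
        · rw [← ENNReal.ofReal_natCast]
          congr 1
          rw [Nat.cast_add, Nat.cast_sub hkn, Nat.cast_one]
        · rw [ENNReal.ofReal_ofNat]
    have r4 : (k : ℝ) + 1 ≤ n := by exact_mod_cast hlt
    obtain ⟨P₁, hP₁, hle₁⟩ := hlin
    by_cases hKk : K₀ ≤ k - 1
    · have hk2 : 2 ≤ k := by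
        have : (2 : ℝ) ≤ k := by linarith
        exact_mod_cast this
      obtain ⟨P₂, hP₂, hle₂⟩ := hsearch.exists_le hb hS hk2 hlt hKk
        fun P hP => hexk P (Or.inl hP) P
      rcases le_or_gt (n : ℝ) (min ((k : ℝ) ^ 2 * S) (n * k)) with h | h
      · refine ⟨P₂, hP₂, le_trans (ENNReal.ofReal_le_ofReal ?_) hle₂⟩
        calc c * (n + min ((k : ℝ) ^ 2 * S) (n * k))
            ≤ b / 64 * (2 * min ((k : ℝ) ^ 2 * S) (n * k)) := by
              gcongr
              linarith
          _ = _ := by ring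
      · refine ⟨P₁, hP₁, le_trans (ENNReal.ofReal_le_ofReal ?_) hle₁⟩
        -- The term `n` can dominate only if `k ≤ n / 2`, where the linear bound is of order `n`.
        have h2k : 2 * (k : ℝ) ≤ n := by
          by_contra hcon
          push Not at hcon
          refine absurd h (not_lt.2 (le_min ?_ ?_))
          · nlinarith
          · nlinarith
        nlinarith
    · refine ⟨P₁, hP₁, le_trans (ENNReal.ofReal_le_ofReal ?_) hle₁⟩
      push Not at hKk
      -- For `k < K₀ + 1`, the whole bound is linear in `n`.
      have h1 : c * (n + min ((k : ℝ) ^ 2 * S) (n * k)) ≤ c * (n * (K₀ + 2)) := by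
        gcongr
        nlinarith
      have h2 : c * (n * (K₀ + 2)) * (8 * (K₀ + 2)) ≤ n := by
        nlinarith
      have h3 : (n : ℝ) ≤ (n - k + 1) / 2 * (8 * (K₀ + 2)) := by
        nlinarith
      have h4 : 0 < 8 * (K₀ + 2) := by linarith
      exact h1.trans (le_of_mul_le_mul_right (h2.trans h3) h4)
  · have hall : ∀ Q : Clustering n, ∀ P, ∀ᵐ p ∂lam P, A.Outputs Q p Q := by
      intro Q P
      rcases hex with h | ⟨_, h, _⟩
      · exact (hac P Q).ae_le (h Q)
      · omega
    refine ⟨ofLabel fun i : Fin n => (i : ℕ), ?_, hconst _ _ ?_⟩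
    · rw [card_parts_singletons, heq]
    · filter_upwards [ae_all_iff.2 fun Q => hall Q _] with p hp
      refine le_trans ?_ (le_numQueries_singletons hp)
      rw [← ENNReal.ofReal_natCast]
      refine ENNReal.ofReal_le_ofReal ?_
      rw [Nat.cast_choose_two]
      nlinarith


variable {n k : ℕ} (A : Algorithm n) {ε : ℝ}

theorem exists_le_expectedQueries_dist1 (hn : 2 ≤ n) (hk : 1 ≤ k) (hkn : k ≤ n) (h0 : 0 < ε)
    (h1 : ε < 1 / 2) (hA : A.Exact (dist1g ε) (dist1r ε) k) :
    ∃ P : Clustering n, P.parts.card = k ∧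
      ENNReal.ofReal (min (1 / (8 * (16 * Real.exp 11 + 2) ^ 2))
        ((1 / 2) ^ 2 / (64 * Real.exp 11) / 64) * (n + min ((k : ℝ) ^ 2 / ε ^ 2) (n * k))) ≤
        A.expectedQueries (dist1g ε) (dist1r ε) P := by
  have hprob := fun P : Clustering n => isProbabilityMeasure_similarityLaw
    (isProbabilityMeasure_dist1g h0 h1) (isProbabilityMeasure_dist1r h0 h1) P
  have : ∀ P, IsProbabilityMeasure (A.law (dist1g ε) (dist1r ε) P) := fun P => by
    rw [law]; infer_instance
  have hac : ∀ P Q, A.law (dist1g ε) (dist1r ε) P ≪ A.law (dist1g ε) (dist1r ε) Q := fun P Q =>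
    Measure.AbsolutelyContinuous.rfl.prod (similarityLaw_dist1_absolutelyContinuous h0 h1 P Q)
  have hS : 2 ≤ 1 / ε ^ 2 := by
    rw [le_div_iff₀ (by positivity)]
    nlinarith
  have hK : 1 ≤ 16 * Real.exp 11 := by
    have := Real.add_one_le_exp (11 : ℝ)
    linarith
  have h := exists_le_lintegral_of_absolutelyContinuous hac hA (by positivity) hS hK
    (A.searchBound_dist1 h0 h1) hn hk hkn
  rwa [mul_one_div] at h

/-- With positive probability, the similarities carry no information at all, and then the number of
queries is large even on average. -/
theorem exists_measure_pos_dist2 (hn : 2 ≤ n) (hk : 1 ≤ k) (hkn : k ≤ n) (h0 : 0 < ε)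
    (h1 : ε < 1 / 2) (hA : A.Exact (dist2g ε) (dist2r ε) k) :
    ∃ P : Clustering n, P.parts.card = k ∧ 0 < A.law (dist2g ε) (dist2r ε) P
      {p | ENNReal.ofReal (1 / 4096 * (n + min ((k : ℝ) ^ 2 / ε) (n * k))) ≤ A.numQueries P p} := by
  have := A.isProbabilityMeasure_overlapLaw h0 h1
  have hac : ∀ P Q, A.overlapLaw ε P ≪ A.overlapLaw ε Q := fun P Q => by
    rw [A.overlapLaw_eq h0 P Q]
  have hrec : ∀ P, A.Recovers (dist2g ε) (dist2r ε) P →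
      ∀ᵐ p ∂A.overlapLaw ε P, A.Outputs P p P :=
    fun P h => (A.overlapLaw_absolutelyContinuous h1 P).ae_le h
  have hS : 2 ≤ 1 / ε := by
    rw [le_div_iff₀ h0]
    linarith
  obtain ⟨P, hP, hle⟩ := exists_le_lintegral_of_absolutelyContinuous hac
    (hA.imp (fun h P => hrec P (h P)) fun ⟨h2, h3, h⟩ => ⟨h2, h3, fun P hP => hrec P (h P hP)⟩)
    (by norm_num) hS (by norm_num) (A.searchBound_overlapLaw h0 h1 (by positivity)) hn hk hkn
  refine ⟨P, hP, ?_⟩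
  rw [mul_one_div] at hle
  set Y : ℝ := n + min ((k : ℝ) ^ 2 / ε) (n * k) with hY
  have hYpos : 0 < Y := by
    have : (2 : ℝ) ≤ n := by exact_mod_cast hn
    have : 0 ≤ min ((k : ℝ) ^ 2 / ε) (n * k) := by positivity
    linarith
  rw [pos_iff_ne_zero]
  intro hzero
  have hz := A.overlapLaw_absolutelyContinuous h1 P hzero
  -- The constant is half of the one for the mean, so an almost sure upper bound contradicts the
  -- lower bound for the mean.
  have hae : ∀ᵐ p ∂A.overlapLaw ε P, A.numQueries P p ≤ ENNReal.ofReal (1 / 4096 * Y) := by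
    have : ∀ᵐ p ∂A.overlapLaw ε P, ¬ ENNReal.ofReal (1 / 4096 * Y) ≤ A.numQueries P p :=
      measure_eq_zero_iff_ae_notMem.1 hz
    filter_upwards [this] with p hp
    exact (not_le.1 hp).le
  have hup : ∫⁻ p, A.numQueries P p ∂A.overlapLaw ε P ≤ ENNReal.ofReal (1 / 4096 * Y) := by
    refine (lintegral_mono_ae hae).trans (le_of_eq ?_)
    simp
  have hcon := hle.trans hup
  rw [ENNReal.ofReal_le_ofReal_iff (by positivity)] at hcon
  norm_num at hcon
  linarith

/-- For `k = n`, the only clustering consists of singletons, and every pair with an uninformative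
similarity must be queried. -/
theorem exists_le_expectedQueries_dist2_singletons (h0 : 0 < ε) (h1 : ε ≤ 1 / 4)
    (hA : ∀ P, A.Recovers (dist2g ε) (dist2r ε) P) :
    ∃ P : Clustering n, P.parts.card = n ∧
      ENNReal.ofReal (n.choose 2 * (1 / 2)) ≤ A.expectedQueries (dist2g ε) (dist2r ε) P := by
  have hprob := fun P : Clustering n => isProbabilityMeasure_similarityLaw
    (isProbabilityMeasure_dist2g (ε := ε) (by linarith))
    (isProbabilityMeasure_dist2r (ε := ε) (by linarith)) P
  set P : Clustering n := ofLabel fun i : Fin n => (i : ℕ) with hP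
  refine ⟨P, card_parts_singletons, ?_⟩
  have hedge : ∀ e ∈ Finset.univ.filter (fun e : Sym2 (Fin n) => ¬ e.IsDiag),
      ENNReal.ofReal (1 / 2) ≤
        ∫⁻ p, A.queryCount {e} P p ∂A.law (dist2g ε) (dist2r ε) P := by
    intro e he
    induction e with
    | _ x y =>
      have hxy : x ≠ y := by simpa using he
      set Q : Clustering n := ofLabel (Function.update (fun i : Fin n => (i : ℕ)) x y) with hQ
      have hsame : ∀ e ∉ ({s(x, y)} : Finset (Sym2 (Fin n))),
          SameCluster P e ↔ SameCluster Q e := by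
        intro e he
        rw [hQ, sameCluster_update fun z hz h' => hz (Fin.ext h')]
        have : e ∉ joinEdges (fun i : Fin n => (i : ℕ)) x y := by
          intro hj
          obtain ⟨z, _, hz, rfl⟩ := mem_joinEdges.1 hj
          rw [Fin.ext hz] at he
          simp at he
        simp [this, hP]
      have hr := restrict_similarityLaw_overlap h0 hsame
      set ρ := A.seedLaw.prod
        ((similarityLaw (dist2g ε) (dist2r ε) P).restrict (overlap ε {s(x, y)})) with hρ
      have hρP : ρ ≤ A.law (dist2g ε) (dist2r ε) P :=
        Measure.prod_mono le_rfl Measure.restrict_le_self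
      have hρQ : ρ ≤ A.law (dist2g ε) (dist2r ε) Q := by
        rw [hρ, hr]
        exact Measure.prod_mono le_rfl Measure.restrict_le_self
      have hone : ∀ᵐ p ∂ρ, 1 ≤ A.queryCount {s(x, y)} P p := by
        filter_upwards [(Measure.absolutelyContinuous_of_le hρP).ae_le (hA P),
          (Measure.absolutelyContinuous_of_le hρQ).ae_le (hA Q)] with p hpP hpQ
        obtain ⟨t, ht⟩ := exists_mem_queries_singletons hxy hpP hpQ
        exact one_le_queryCount ht (Finset.mem_singleton_self _)
      calc ENNReal.ofReal (1 / 2) ≤ ρ Set.univ := by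
            rw [hρ, ← Set.univ_prod_univ, Measure.prod_prod, measure_univ, one_mul,
              Measure.restrict_apply_univ, similarityLaw_overlap h0 (by linarith)]
            refine ENNReal.ofReal_le_ofReal ?_
            rw [Finset.card_singleton, pow_one, le_div_iff₀ (by linarith)]
            linarith
        _ = ∫⁻ _, 1 ∂ρ := by simp
        _ ≤ ∫⁻ p, A.queryCount {s(x, y)} P p ∂ρ := lintegral_mono_ae hone
        _ ≤ _ := lintegral_mono' hρP le_rfl
  calc ENNReal.ofReal (n.choose 2 * (1 / 2))
      = ∑ e ∈ Finset.univ.filter (fun e : Sym2 (Fin n) => ¬ e.IsDiag), ENNReal.ofReal (1 / 2) := by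
        rw [Finset.sum_const, card_filter_not_isDiag, nsmul_eq_mul,
          ENNReal.ofReal_mul (Nat.cast_nonneg _), ENNReal.ofReal_natCast]
    _ ≤ _ := Finset.sum_le_sum hedge
    _ = ∫⁻ p, ∑ e ∈ Finset.univ.filter (fun e : Sym2 (Fin n) => ¬ e.IsDiag),
          A.queryCount {e} P p ∂A.law (dist2g ε) (dist2r ε) P := by
        rw [lintegral_finsetSum _ fun e _ => A.measurable_queryCount _ _]
    _ ≤ _ := lintegral_mono fun p => sum_queryCount_singleton_le _ P p

end Algorithm

end CrowdER

theorem proposition1 :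
    ∃ c : ℝ, 0 < c ∧
      ∀ (n k : ℕ), 2 ≤ n → 1 ≤ k → k ≤ n → ∀ ε : ℝ, 0 < ε → ε < 1 / 2 →
      ∀ A : CrowdER.Algorithm n,
        -- Dist-1
        (A.Exact (CrowdER.dist1g ε) (CrowdER.dist1r ε) k →
          ∃ P : CrowdER.Clustering n, P.parts.card = k ∧
            ENNReal.ofReal (c * (n + min ((k : ℝ) ^ 2 / ε ^ 2) (n * k))) ≤
              A.expectedQueries (CrowdER.dist1g ε) (CrowdER.dist1r ε) P) ∧
        -- Dist-2, in the worst case over the random realizations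
        (A.Exact (CrowdER.dist2g ε) (CrowdER.dist2r ε) k →
          ∃ P : CrowdER.Clustering n, P.parts.card = k ∧
            0 < A.law (CrowdER.dist2g ε) (CrowdER.dist2r ε) P
              {p | ENNReal.ofReal (c * (n + min ((k : ℝ) ^ 2 / ε) (n * k))) ≤
                A.numQueries P p}) ∧
        -- Dist-2, in expectation
        (A.Exact (CrowdER.dist2g ε) (CrowdER.dist2r ε) k → 3 ≤ k → ε ≤ 1 / 4 →
          ∃ P : CrowdER.Clustering n, P.parts.card = k ∧
            ENNReal.ofReal (c * min ((k : ℝ) ^ 2 / ε) (n * k)) ≤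
              A.expectedQueries (CrowdER.dist2g ε) (CrowdER.dist2r ε) P) := by
  obtain ⟨b, hb, hsearch⟩ := CrowdER.Algorithm.searchBound_dist2
  set c₁ : ℝ := min (1 / (8 * (16 * Real.exp 11 + 2) ^ 2))
    ((1 / 2) ^ 2 / (64 * Real.exp 11) / 64)
  have hc₁ : 0 < c₁ := by positivity
  set c := min c₁ (min (1 / 4096) (b / 32)) with hc
  have hle₁ : c ≤ c₁ := min_le_left _ _
  have hle₂ : c ≤ 1 / 4096 := (min_le_right _ _).trans (min_le_left _ _)
  have hle₃ : c ≤ b / 32 := (min_le_right _ _).trans (min_le_right _ _)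
  refine ⟨c, by positivity, fun n k hn hk hkn ε h0 h1 A => ⟨fun hA => ?_, fun hA => ?_, ?_⟩⟩
  · obtain ⟨P, hP, h⟩ := A.exists_le_expectedQueries_dist1 hn hk hkn h0 h1 hA
    refine ⟨P, hP, le_trans (ENNReal.ofReal_le_ofReal ?_) h⟩
    gcongr
  · obtain ⟨P, hP, h⟩ := A.exists_measure_pos_dist2 hn hk hkn h0 h1 hA
    refine ⟨P, hP, h.trans_le (measure_mono fun p hp => ?_)⟩
    refine le_trans (ENNReal.ofReal_le_ofReal ?_) hp
    gcongr
  · intro hA hk3 hε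
    have r1 : (3 : ℝ) ≤ k := by exact_mod_cast hk3
    have hrec : ∀ P : CrowdER.Clustering n, P.parts.card = k →
        A.Recovers (CrowdER.dist2g ε) (CrowdER.dist2r ε) P := by
      intro P hP
      rcases hA with h | ⟨_, _, h⟩
      · exact h P
      · exact h P hP
    rcases hkn.lt_or_eq with hlt | heq
    · have hS : 2 ≤ 1 / ε := by
        rw [le_div_iff₀ h0]
        linarith
      obtain ⟨P, hP, h⟩ := (hsearch A h0 hε).exists_le hb hS (by omega) hlt (by linarith) hrec
      refine ⟨P, hP, le_trans (ENNReal.ofReal_le_ofReal ?_) h⟩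
      rw [mul_one_div]
      gcongr
    · subst heq
      have hall := hA.resolve_right fun h => absurd h.2.1 (lt_irrefl _)
      obtain ⟨P, hP, h⟩ := A.exists_le_expectedQueries_dist2_singletons h0 hε hall
      refine ⟨P, hP, le_trans (ENNReal.ofReal_le_ofReal ?_) h⟩
      calc c * min ((k : ℝ) ^ 2 / ε) (k * k) ≤ 1 / 4096 * (k * k) := by
            gcongr
            exact min_le_right _ _
        _ ≤ k.choose 2 * (1 / 2) := by
            rw [Nat.cast_choose_two]
            nlinarith
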